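/- Conventions. An operator space is a closed linear subspace $X\subseteq B(H)$ for a complex Hilbert space $H$; $M_n(X)$ carries the norm inherited from $B(H\oplus\cdots\oplus H)$ ($n$ summands). For a linear map $\phi:X\to Y$ between operator spaces, $\|\phi\|_{cb}=\sup_n\|\mathrm{id}_{M_n}\otimes\phi\|\in[0,\infty]$, and $\phi$ is a complete contraction (respectively, a complete isometry) if every $\mathrm{id}_{M_n}\otimes\phi:M_n(X)\to M_n(Y)$ is a contraction (respectively, an isometry). If $\phi$ is injective, $\phi^{-1}$ denotes the inverse defined on the range of $\phi$. For finite-dimensional operator spaces, $d_{cb}(E,F)=\inf\|\phi\|_{cb}\|\phi^{-1}\|_{cb}$ over all linear isomorphisms $\phi:E\to F$, and $ex(E)=\inf d_{cb}(E,F)$ over all $n$ and all linear subspaces $F\subseteq M_n=M_n(\mathbb{C})$. For an arbitrary operator space $X$, $ex(X)$ is the supremum of $ex(E)$ over all finite-dimensional subspaces $E\subseteq X$. The space $X$ is $1$-exact if $X=\{0\}$ or $ex(X)=1$, that is, if $ex(X)\le 1$. Proposition. Let $X$ and $Y$ be finite-dimensional $1$-exact operator spaces and let $X_0\subseteq X$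 be a linear subspace. (1) Let $\delta\ge 0$, $\varepsilon>0$, and let $f:X_0\to Y$ be an injective linear complete contraction with $\|f^{-1}\|_{cb}\le 1+\delta$. Then there are a separable $1$-exact operator space $Z$ and linear complete isometries $i:X\to Z$ and $j:Y\to Z$ such that $\|j\circ f-i|_{X_0}\|_{cb}\le\delta+\varepsilon$. (2) In particular, the class of finite-dimensional $1$-exact operator spaces has the near amalgamation property: if $f:X_0\to Y$ is a linear complete isometry and $\varepsilon>0$, then there are a finite-dimensional $1$-exact operator space $Z$ and linear complete isometries $i:X\to Z$ and $j:Y\to Z$ such that $\|j\circ f-i|_{X_0}\|_{cb}\le\varepsilon$. -/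

import Mathlib

open scoped ENNReal

/-!
# Operator spaces

A (concrete) operator space is a closed linear subspace of `B(H)` for a complex Hilbert space `H`;
here it is a `Submodule ℂ (H →L[ℂ] H)`, closedness being automatic in finite dimension and
stated explicitly otherwise. The matrix norms and the notions derived from them do not
refer to closedness.
-/

noncomputable section

namespace OperatorSpace

variable {H K : Type*}
  [NormedAddCommGroup H] [InnerProductSpace ℂ H]
  [NormedAddCommGroup K] [InnerProductSpace ℂ K]

/-- The operator on the Hilbert space direct sum `H ⊕ ⋯ ⊕ H` (`n` copies) given by an `n × n`
matrix of operators on `H`: the identification `M_n(B(H)) = B(H ⊕ ⋯ ⊕ H)`. -/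
def blockOperator {n : ℕ} (x : Matrix (Fin n) (Fin n) (H →L[ℂ] H)) :
    PiLp 2 (fun _ : Fin n => H) →L[ℂ] PiLp 2 (fun _ : Fin n => H) :=
  (PiLp.continuousLinearEquiv 2 ℂ (fun _ : Fin n => H)).symm.toContinuousLinearMap ∘L
    ContinuousLinearMap.pi fun i =>
      ∑ j, x i j ∘L PiLp.proj (𝕜 := ℂ) 2 (fun _ : Fin n => H) j

theorem blockOperator_apply {n : ℕ} (x : Matrix (Fin n) (Fin n) (H →L[ℂ] H))
    (v : PiLp 2 (fun _ : Fin n => H)) (i : Fin n) :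
    blockOperator x v i = ∑ j, x i j (v j) := by
  simp [blockOperator]

/-- The norm of `M_n(X)`, for a linear subspace `X` of `B(H)`, inherited from
`M_n(X) ⊆ M_n(B(H)) = B(H ⊕ ⋯ ⊕ H)`. -/
def matNorm {X : Submodule ℂ (H →L[ℂ] H)} {n : ℕ} (x : Matrix (Fin n) (Fin n) X) : ℝ :=
  ‖blockOperator (x.map fun a => (a : H →L[ℂ] H))‖

/-- The completely bounded norm `‖φ‖_cb = sup_n ‖id_{M_n} ⊗ φ‖`, as an extended nonnegative real;
it is `∞` exactly when `φ` is not completely bounded. -/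
def cbNorm {X : Submodule ℂ (H →L[ℂ] H)} {Y : Submodule ℂ (K →L[ℂ] K)} (φ : X →ₗ[ℂ] Y) : ℝ≥0∞ :=
  ⨆ (n : ℕ) (x : Matrix (Fin n) (Fin n) X) (_ : matNorm x ≤ 1), ENNReal.ofReal (matNorm (x.map φ))

/-- A complete contraction: every amplification `id_{M_n} ⊗ φ` is a contraction. -/
def IsCompleteContraction {X : Submodule ℂ (H →L[ℂ] H)} {Y : Submodule ℂ (K →L[ℂ] K)}
    (φ : X →ₗ[ℂ] Y) : Prop :=
  ∀ (n : ℕ) (x : Matrix (Fin n) (Fin n) X), matNorm (x.map φ) ≤ matNorm x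

/-- A complete isometry: every amplification `id_{M_n} ⊗ φ` is an isometry. -/
def IsCompleteIsometry {X : Submodule ℂ (H →L[ℂ] H)} {Y : Submodule ℂ (K →L[ℂ] K)}
    (φ : X →ₗ[ℂ] Y) : Prop :=
  ∀ (n : ℕ) (x : Matrix (Fin n) (Fin n) X), matNorm (x.map φ) = matNorm x

theorem subtype_comp_injective {X : Submodule ℂ (H →L[ℂ] H)} {Y : Submodule ℂ (K →L[ℂ] K)}
    {φ : X →ₗ[ℂ] Y} (hφ : Function.Injective φ) : Function.Injective (Y.subtype ∘ₗ φ) :=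
  Y.injective_subtype.comp hφ

/-- The inverse `φ⁻¹ : φ(X) → X` of an injective linear map `φ : X → Y`, its domain being the range
of `φ` as a linear subspace of `Y ⊆ B(K)`. -/
def inverseOnRange {X : Submodule ℂ (H →L[ℂ] H)} {Y : Submodule ℂ (K →L[ℂ] K)}
    (φ : X →ₗ[ℂ] Y) (hφ : Function.Injective φ) :
    LinearMap.range (Y.subtype ∘ₗ φ) →ₗ[ℂ] X :=
  (LinearEquiv.ofInjective (Y.subtype ∘ₗ φ) (subtype_comp_injective hφ)).symm.toLinearMap

/-- The completely bounded distance `d_cb(E, F) = inf ‖φ‖_cb ‖φ⁻¹‖_cb` over all linear isomorphisms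
`φ : E → F` (equal to `∞` if there are none). -/
def cbDist (E : Submodule ℂ (H →L[ℂ] H)) (F : Submodule ℂ (K →L[ℂ] K)) : ℝ≥0∞ :=
  ⨅ φ : E ≃ₗ[ℂ] F, cbNorm φ.toLinearMap * cbNorm φ.symm.toLinearMap

/-- The exactness constant of a finite-dimensional operator space: the infimum of `d_cb(E, F)` over
all linear subspaces `F` of `M_n = B(ℂⁿ)` and all `n`. -/
def exactnessConstantFin (E : Submodule ℂ (H →L[ℂ] H)) : ℝ≥0∞ :=
  ⨅ (n : ℕ) (F : Submodule ℂ (EuclideanSpace ℂ (Fin n) →L[ℂ] EuclideanSpace ℂ (Fin n))),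
    cbDist E F

/-- The exactness constant of an operator space: the supremum of the exactness constants
of its finite-dimensional subspaces. -/
def exactnessConstant (X : Submodule ℂ (H →L[ℂ] H)) : ℝ≥0∞ :=
  ⨆ (E : Submodule ℂ (H →L[ℂ] H)) (_ : E ≤ X) (_ : FiniteDimensional ℂ E), exactnessConstantFin E

/-- `1`-exactness: the exactness constant is `1`. It is at least `1` for every nonzero space; the
inequality is used because the zero space, which is `1`-exact, has constant `0` by the formula. -/
def IsOneExact (X : Submodule ℂ (H →L[ℂ] H)) : Prop :=
  exactnessConstant X ≤ 1

end OperatorSpace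

end

/-!
# Near amalgamation of finite-dimensional `1`-exact operator spaces

An amalgam of `X` and `Y` is encoded as a linear map `T` from `X × Y` to some `B(K)`; the operator
space is the range of `T`, and its matrix norms are `ampNorm T`.

If `X` and `Y` were spaces of matrices, `X ⊆ M_k` and `Y ⊆ M_m`, an amalgam would be given by
complete contractions `A : Y → M_k` extending `(1 + δ)⁻¹ f⁻¹` and `B : X → M_m` extending `f`,
through `T (x, y) = (x + A y, B x + y)`. Such extensions exist because `M_n` is injective
(`exists_extension`): maps `V → M_n` are functionals on `M_n(V)`, complete contractivity is
contractivity for the predual norm `predualSeminorm`, and this norm restricts well to subspaces,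
so that the Hahn–Banach theorem applies. A `1`-exact space embeds into matrices only up to
arbitrarily small distortion, so the same construction gives an amalgam with a small distortion
`η` on `X` and `Y` (`exists_initial_amalgam`). Small multiples of the coordinates are added to `T`
so that its norm is equivalent to the norm of `X ⊕ Y`.

The distortion is then removed in infinitely many steps. Given an amalgam `T` of distortion `η`
and an embedding `φ : X → M_n` of distortion `η'`, the map `(1 + η)⁻¹ φ` is dominated by `T` on
`X`, hence extends to a map `Φ` on `X × Y` dominated by `T`; adding `η (1 + η)⁻¹ φ` in the first
variable yields a map `S` that restricts to `φ` on `X` and exceeds `T` by at most `η ‖x‖`. The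
direct sum of `T`, `S`, and the similar map for `Y` has distortion `η'`
(`IsAlmostIsometric.exists_improvement`). For `η_k = e / 2 ^ (k + 1)` the resulting seminorms
increase, and by equivalence with the norm of `X ⊕ Y` they converge with relative error tending to
zero. Hence their supremum, realized by a block diagonal sum, is completely isometric on `X` and
on `Y`, is `1`-exact, and differs little from the first amalgam
(`IsAlmostIsometric.exists_limit`).
-/

/-! ### Forms of operator matrices and amplified norms -/

noncomputable section

namespace OperatorSpace

open scoped InnerProductSpace ComplexConjugate

section Forms

variable {H : Type*} [NormedAddCommGroup H] [InnerProductSpace ℂ H]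

/-- The sesquilinear form on `Hⁿ` of an `n × n` matrix of operators on `H`. -/
def blockForm {n : ℕ} (w : Matrix (Fin n) (Fin n) (H →L[ℂ] H)) (η ξ : Fin n → H) : ℂ :=
  ∑ i, ∑ j, ⟪η i, w i j (ξ j)⟫_ℂ

/-- The quadratic form on `Hⁿ` given by a matrix of scalars. -/
def scalarForm {n : ℕ} (A : Matrix (Fin n) (Fin n) ℂ) (ξ : Fin n → H) : ℝ :=
  (∑ i, ∑ j, A i j * ⟪ξ i, ξ j⟫_ℂ).re

/-- A matrix of scalars acting on tuples of vectors. -/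
def scalarAct {m n : ℕ} (β : Matrix (Fin m) (Fin n) ℂ) (ξ : Fin n → H) : Fin m → H :=
  fun k => ∑ j, β k j • ξ j

theorem inner_blockOperator {n : ℕ} (w : Matrix (Fin n) (Fin n) (H →L[ℂ] H))
    (y x : PiLp 2 (fun _ : Fin n => H)) :
    ⟪y, blockOperator w x⟫_ℂ = blockForm w y.ofLp x.ofLp := by
  simp [PiLp.inner_apply, blockForm, blockOperator_apply, inner_sum]

/-- The form is bounded by the norm, in the additive shape that the inequality between arithmetic
and geometric mean gives. -/
theorem norm_blockForm_le {n : ℕ} (w : Matrix (Fin n) (Fin n) (H →L[ℂ] H)) (η ξ : Fin n → H) :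
    ‖blockForm w η ξ‖ ≤ ‖blockOperator w‖ / 2 * (∑ i, ‖η i‖ ^ 2 + ∑ i, ‖ξ i‖ ^ 2) := by
  have h := inner_blockOperator w (WithLp.toLp 2 η) (WithLp.toLp 2 ξ)
  have hη := PiLp.norm_sq_eq_of_L2 (fun _ : Fin n => H) (WithLp.toLp 2 η)
  have hξ := PiLp.norm_sq_eq_of_L2 (fun _ : Fin n => H) (WithLp.toLp 2 ξ)
  simp only at h hη hξ
  rw [← h, ← hη, ← hξ]
  set a := WithLp.toLp 2 η
  set b := WithLp.toLp 2 ξ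
  have h1 := norm_inner_le_norm (𝕜 := ℂ) a (blockOperator w b)
  have h2 := (blockOperator w).le_opNorm b
  have h3 := mul_le_mul_of_nonneg_left h2 (norm_nonneg a)
  nlinarith [mul_nonneg (norm_nonneg (blockOperator w)) (sq_nonneg (‖a‖ - ‖b‖))]

/-- The norm of an operator matrix is controlled by its form. The bound may be taken additive in
`‖η‖²` and `‖ξ‖²`, which makes it stable under direct sums. -/
theorem norm_blockOperator_le {n : ℕ} {w : Matrix (Fin n) (Fin n) (H →L[ℂ] H)} {c : ℝ}
    (hc : 0 ≤ c)
    (h : ∀ η ξ : Fin n → H,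
      ‖blockForm w η ξ‖ ≤ c / 2 * (∑ i, ‖η i‖ ^ 2 + ∑ i, ‖ξ i‖ ^ 2)) :
    ‖blockOperator w‖ ≤ c := by
  refine ContinuousLinearMap.opNorm_le_of_re_inner_le (𝕜 := ℂ) hc fun x y hx hy => ?_
  have h1 := h y.ofLp x.ofLp
  rw [← inner_blockOperator, ← PiLp.norm_sq_eq_of_L2 (fun _ : Fin n => H) y,
    ← PiLp.norm_sq_eq_of_L2 (fun _ : Fin n => H) x, hx, hy, norm_inner_symm] at h1
  refine (RCLike.re_le_norm _).trans (h1.trans (le_of_eq ?_))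
  ring

theorem scalarForm_add {n : ℕ} (A B : Matrix (Fin n) (Fin n) ℂ) (ξ : Fin n → H) :
    scalarForm (A + B) ξ = scalarForm A ξ + scalarForm B ξ := by
  simp [scalarForm, add_mul, Finset.sum_add_distrib]

theorem scalarForm_smul {n : ℕ} (r : ℝ) (A : Matrix (Fin n) (Fin n) ℂ) (ξ : Fin n → H) :
    scalarForm (r • A) ξ = r * scalarForm A ξ := by
  have : ∑ i, ∑ j, (r • A) i j * ⟪ξ i, ξ j⟫_ℂ = (r : ℂ) * ∑ i, ∑ j, A i j * ⟪ξ i, ξ j⟫_ℂ := by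
    simp [Finset.mul_sum, mul_assoc]
  rw [scalarForm, this, Complex.re_ofReal_mul, scalarForm]

theorem scalarForm_one {n : ℕ} (ξ : Fin n → H) :
    scalarForm (1 : Matrix (Fin n) (Fin n) ℂ) ξ = ∑ i, ‖ξ i‖ ^ 2 := by
  simp only [scalarForm, Matrix.one_apply, ite_mul, one_mul, zero_mul, Finset.sum_ite_eq,
    Finset.mem_univ, if_true, Complex.re_sum]
  refine Finset.sum_congr rfl fun i _ => ?_
  rw [inner_self_eq_norm_sq_to_K]
  norm_cast

/-- The identity `⟨βᴴ β ξ, ξ⟩ = ‖β ξ‖²`, for vectors `ξ` with entries in a Hilbert space. -/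
theorem scalarForm_conjTranspose_mul_self {m n : ℕ} (β : Matrix (Fin m) (Fin n) ℂ)
    (ξ : Fin n → H) :
    scalarForm (β.conjTranspose * β) ξ = ∑ k, ‖scalarAct β ξ k‖ ^ 2 := by
  have h : ∀ k, ‖scalarAct β ξ k‖ ^ 2 = (∑ i, ∑ j, conj (β k i) * β k j * ⟪ξ i, ξ j⟫_ℂ).re := by
    intro k
    have : ((‖scalarAct β ξ k‖ ^ 2 : ℝ) : ℂ) = ⟪scalarAct β ξ k, scalarAct β ξ k⟫_ℂ := by
      rw [inner_self_eq_norm_sq_to_K]; norm_cast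
    rw [← Complex.ofReal_re (‖scalarAct β ξ k‖ ^ 2), this]
    simp only [scalarAct, sum_inner, inner_sum, inner_smul_left, inner_smul_right,
      Finset.mul_sum]
    rw [Finset.sum_comm]
    congr 1
    refine Finset.sum_congr rfl fun i _ => Finset.sum_congr rfl fun j _ => ?_
    ring
  simp only [h, scalarForm, ← Complex.re_sum]
  congr 1
  rw [Finset.sum_comm (s := Finset.univ (α := Fin m))]
  refine Finset.sum_congr rfl fun i _ => ?_
  rw [Finset.sum_comm (s := Finset.univ (α := Fin m))]
  refine Finset.sum_congr rfl fun j _ => ?_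
  simp [Matrix.mul_apply, Finset.sum_mul]

theorem scalarAct_scalarAct {l m n : ℕ} (α : Matrix (Fin l) (Fin m) ℂ)
    (β : Matrix (Fin m) (Fin n) ℂ) (ξ : Fin n → H) :
    scalarAct α (scalarAct β ξ) = scalarAct (α * β) ξ := by
  funext k
  simp only [scalarAct, Finset.smul_sum, smul_smul, Matrix.mul_apply, Finset.sum_smul]
  rw [Finset.sum_comm]

theorem scalarAct_one {n : ℕ} (ξ : Fin n → H) :
    scalarAct (1 : Matrix (Fin n) (Fin n) ℂ) ξ = ξ := by
  funext k
  simp [scalarAct, Matrix.one_apply]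

end Forms

section Compression

variable {V : Type*} [AddCommGroup V] [Module ℂ V]

/-- The product `αᴴ v β`, for matrices of scalars `α`, `β` and a matrix `v` over a vector space. -/
def compression {m n : ℕ} (α β : Matrix (Fin m) (Fin n) ℂ) (v : Matrix (Fin m) (Fin m) V) :
    Matrix (Fin n) (Fin n) V :=
  fun k l => ∑ i, ∑ j, (conj (α i k) * β j l) • v i j

theorem compression_map {U : Type*} [AddCommGroup U] [Module ℂ U] {m n : ℕ}
    (α β : Matrix (Fin m) (Fin n) ℂ) (v : Matrix (Fin m) (Fin m) V) (T : V →ₗ[ℂ] U) :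
    (compression α β v).map T = compression α β (v.map T) := by
  ext k l
  simp [compression]

theorem compression_compression {l m n : ℕ} (α β : Matrix (Fin m) (Fin n) ℂ)
    (γ δ : Matrix (Fin l) (Fin m) ℂ) (v : Matrix (Fin l) (Fin l) V) :
    compression α β (compression γ δ v) = compression (γ * α) (δ * β) v := by
  ext k l'
  simp only [compression, Finset.smul_sum, smul_smul, Matrix.mul_apply, map_sum, map_mul,
    Finset.sum_mul_sum, Finset.sum_smul]
  have : ∀ (p q : Fin m), ∑ i : Fin l, ∑ j : Fin l,
      (conj (α p k) * β q l' * (conj (γ i p) * δ j q)) • v i j =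
      ∑ i : Fin l, ∑ j : Fin l, (conj (γ i p) * conj (α p k) * (δ j q * β q l')) • v i j :=
    fun p q => Finset.sum_congr rfl fun i _ => Finset.sum_congr rfl fun j _ => by
      congr 1; ring
  simp only [this]
  calc _ = ∑ p : Fin m, ∑ i : Fin l, ∑ q : Fin m, ∑ j : Fin l,
        (conj (γ i p) * conj (α p k) * (δ j q * β q l')) • v i j :=
        Finset.sum_congr rfl fun p _ => Finset.sum_comm
    _ = ∑ i : Fin l, ∑ p : Fin m, ∑ q : Fin m, ∑ j : Fin l,
        (conj (γ i p) * conj (α p k) * (δ j q * β q l')) • v i j := Finset.sum_comm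
    _ = ∑ i : Fin l, ∑ p : Fin m, ∑ j : Fin l, ∑ q : Fin m,
        (conj (γ i p) * conj (α p k) * (δ j q * β q l')) • v i j :=
        Finset.sum_congr rfl fun i _ => Finset.sum_congr rfl fun p _ => Finset.sum_comm
    _ = _ := Finset.sum_congr rfl fun i _ => Finset.sum_comm

theorem compression_one {n : ℕ} (v : Matrix (Fin n) (Fin n) V) :
    compression (1 : Matrix (Fin n) (Fin n) ℂ) 1 v = v := by
  ext k l
  simp [compression, Matrix.one_apply, ite_smul]

theorem blockForm_compression {H : Type*} [NormedAddCommGroup H] [InnerProductSpace ℂ H]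
    {m n : ℕ} (α β : Matrix (Fin m) (Fin n) ℂ) (w : Matrix (Fin m) (Fin m) (H →L[ℂ] H))
    (η ξ : Fin n → H) :
    blockForm (compression α β w) η ξ = blockForm w (scalarAct α η) (scalarAct β ξ) := by
  simp only [blockForm, compression, scalarAct, _root_.sum_apply,
    _root_.smul_apply, inner_sum, sum_inner, map_sum, map_smul, inner_smul_left,
    inner_smul_right]
  calc _ = ∑ k : Fin n, ∑ i : Fin m, ∑ l : Fin n, ∑ j : Fin m,
        conj (α i k) * β j l * ⟪η k, w i j (ξ l)⟫_ℂ :=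
        Finset.sum_congr rfl fun k _ => Finset.sum_comm
    _ = ∑ i : Fin m, ∑ k : Fin n, ∑ l : Fin n, ∑ j : Fin m,
        conj (α i k) * β j l * ⟪η k, w i j (ξ l)⟫_ℂ := Finset.sum_comm
    _ = ∑ i : Fin m, ∑ k : Fin n, ∑ j : Fin m, ∑ l : Fin n,
        conj (α i k) * β j l * ⟪η k, w i j (ξ l)⟫_ℂ :=
        Finset.sum_congr rfl fun i _ => Finset.sum_congr rfl fun k _ => Finset.sum_comm
    _ = ∑ i : Fin m, ∑ j : Fin m, ∑ k : Fin n, ∑ l : Fin n,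
        conj (α i k) * β j l * ⟪η k, w i j (ξ l)⟫_ℂ :=
        Finset.sum_congr rfl fun i _ => Finset.sum_comm
    _ = _ := by
      refine Finset.sum_congr rfl fun i _ => Finset.sum_congr rfl fun j _ => ?_
      rw [Finset.sum_comm]
      refine Finset.sum_congr rfl fun l _ => ?_
      simp only [Finset.mul_sum]
      refine Finset.sum_congr rfl fun k _ => ?_
      ring

end Compression

section AmpNorm

variable {H : Type*} [NormedAddCommGroup H] [InnerProductSpace ℂ H]
  {V : Type*} [AddCommGroup V] [Module ℂ V]

/-- The norm of the amplification `id_{M_n} ⊗ T` of a linear map `T : V → B(H)` at a matrix over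
`V`; as a function of the matrix it is the matricial seminorm pulled back along `T`. -/
def ampNorm (T : V →ₗ[ℂ] H →L[ℂ] H) {n : ℕ} (v : Matrix (Fin n) (Fin n) V) : ℝ :=
  ‖blockOperator (v.map T)‖

theorem blockOperator_add {n : ℕ} (v w : Matrix (Fin n) (Fin n) (H →L[ℂ] H)) :
    blockOperator (v + w) = blockOperator v + blockOperator w := by
  ext x i
  simp [blockOperator_apply, Finset.sum_add_distrib]

theorem blockOperator_smul {n : ℕ} (a : ℂ) (v : Matrix (Fin n) (Fin n) (H →L[ℂ] H)) :
    blockOperator (a • v) = a • blockOperator v := by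
  ext x i
  simp [blockOperator_apply, Finset.smul_sum]

theorem norm_blockOperator_smul {n : ℕ} (a : ℂ) (v : Matrix (Fin n) (Fin n) (H →L[ℂ] H)) :
    ‖blockOperator (a • v)‖ = ‖a‖ * ‖blockOperator v‖ := by
  have key : ∀ {E : Type _} [NormedAddCommGroup E] [NormedSpace ℂ E] (A : E →L[ℂ] E),
      ‖a • A‖ = ‖a‖ * ‖A‖ := fun A => norm_smul a A
  rw [blockOperator_smul]
  exact key (blockOperator v)

theorem eq_zero_of_norm_blockOperator {n : ℕ} {v : Matrix (Fin n) (Fin n) (H →L[ℂ] H)}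
    (h : ‖blockOperator v‖ = 0) : v = 0 := by
  have h0 : ∀ x, blockOperator v x = 0 := fun x => by
    have := (blockOperator v).le_opNorm x
    rw [h, zero_mul] at this
    exact norm_le_zero_iff.1 this
  ext i j ξ
  have := congrArg (fun y => y i) (h0 (WithLp.toLp 2 (Pi.single j ξ)))
  simp only [blockOperator_apply] at this
  rw [Finset.sum_eq_single j (fun k _ hk => by simp [Pi.single_eq_of_ne hk]) (by simp)] at this
  simpa using this

theorem ampNorm_nonneg (T : V →ₗ[ℂ] H →L[ℂ] H) {n : ℕ} (v : Matrix (Fin n) (Fin n) V) :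
    0 ≤ ampNorm T v :=
  norm_nonneg (blockOperator (v.map T))

theorem ampNorm_map {U : Type*} [AddCommGroup U] [Module ℂ U] (T : V →ₗ[ℂ] H →L[ℂ] H)
    (S : U →ₗ[ℂ] V) {n : ℕ} (v : Matrix (Fin n) (Fin n) U) :
    ampNorm T (v.map S) = ampNorm (T ∘ₗ S) v := by
  simp only [ampNorm, Matrix.map_map]
  rfl

theorem ampNorm_congr {U : Type*} [AddCommGroup U] [Module ℂ U] {T : V →ₗ[ℂ] H →L[ℂ] H}
    {S : U →ₗ[ℂ] H →L[ℂ] H} {n : ℕ} {v : Matrix (Fin n) (Fin n) V} {u : Matrix (Fin n) (Fin n) U}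
    (h : ∀ i j, T (v i j) = S (u i j)) : ampNorm T v = ampNorm S u := by
  have : v.map T = u.map S := Matrix.ext h
  rw [ampNorm, this, ampNorm]

theorem ampNorm_eq_norm_mul {U : Type*} [AddCommGroup U] [Module ℂ U] {T : V →ₗ[ℂ] H →L[ℂ] H}
    {S : U →ₗ[ℂ] H →L[ℂ] H} {n : ℕ} {v : Matrix (Fin n) (Fin n) V} {u : Matrix (Fin n) (Fin n) U}
    (a : ℂ) (h : ∀ i j, T (v i j) = a • S (u i j)) : ampNorm T v = ‖a‖ * ampNorm S u := by
  have : v.map T = a • u.map S := Matrix.ext h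
  rw [ampNorm, this, norm_blockOperator_smul, ampNorm]

theorem ampNorm_add_le (T S : V →ₗ[ℂ] H →L[ℂ] H) {n : ℕ} (v : Matrix (Fin n) (Fin n) V) :
    ampNorm (T + S) v ≤ ampNorm T v + ampNorm S v := by
  have : v.map (T + S) = v.map T + v.map S := by ext; simp
  simp only [ampNorm, this, blockOperator_add]
  exact norm_add_le (blockOperator (v.map T)) (blockOperator (v.map S))

theorem ampNorm_smul (a : ℂ) (T : V →ₗ[ℂ] H →L[ℂ] H) {n : ℕ} (v : Matrix (Fin n) (Fin n) V) :
    ampNorm (a • T) v = ‖a‖ * ampNorm T v := by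
  have : v.map (a • T) = a • v.map T := by ext; simp
  simp only [ampNorm, this, norm_blockOperator_smul]

theorem ampNorm_apply_smul (a : ℂ) (T : V →ₗ[ℂ] H →L[ℂ] H) {n : ℕ}
    (v : Matrix (Fin n) (Fin n) V) : ampNorm T (a • v) = ‖a‖ * ampNorm T v := by
  have : (a • v).map T = a • v.map T := by ext; simp
  simp only [ampNorm, this, norm_blockOperator_smul]

theorem ampNorm_eq_zero {T : V →ₗ[ℂ] H →L[ℂ] H} {n : ℕ} {v : Matrix (Fin n) (Fin n) V}
    (h : v.map T = 0) : ampNorm T v = 0 := by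
  have := norm_blockOperator_smul 0 (v.map T)
  rwa [zero_smul, norm_zero, zero_mul, ← h] at this

theorem norm_le_ampNorm (T : V →ₗ[ℂ] H →L[ℂ] H) (x : V) :
    ‖T x‖ ≤ ampNorm T (Matrix.of fun _ _ : Fin 1 => x) := by
  refine ContinuousLinearMap.opNorm_le_bound _ (ampNorm_nonneg _ _) fun ξ => ?_
  have h := (blockOperator ((Matrix.of fun _ _ : Fin 1 => x).map T)).le_opNorm
    (WithLp.toLp 2 fun _ => ξ)
  simpa [PiLp.norm_eq_of_L2, blockOperator_apply, ampNorm] using h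

/-- The amplified seminorms determine the kernel. -/
theorem eq_zero_of_ampNorm_eq_zero (T : V →ₗ[ℂ] H →L[ℂ] H) {x : V}
    (h : ampNorm T (Matrix.of fun _ _ : Fin 1 => x) = 0) : T x = 0 := by
  exact congrFun (congrFun (eq_zero_of_norm_blockOperator h) 0) 0

end AmpNorm

end OperatorSpace

end

/-! ### Extension of complete contractions into matrix algebras -/

noncomputable section

namespace OperatorSpace

open scoped InnerProductSpace ComplexConjugate ComplexOrder

section Wittstock

variable {H : Type*} [NormedAddCommGroup H] [InnerProductSpace ℂ H]
  {V : Type*} [AddCommGroup V] [Module ℂ V]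

/-- The form of the operator matrix `w` is dominated by the positive scalar matrices `A` and `B`;
up to passing to invertible ones, this says that `w = αᴴ v β` with `‖v‖ ≤ 1`, `αᴴ α = A` and
`βᴴ β = B`. -/
def IsDominated {n : ℕ} (w : Matrix (Fin n) (Fin n) (H →L[ℂ] H))
    (A B : Matrix (Fin n) (Fin n) ℂ) : Prop :=
  A.PosSemidef ∧ B.PosSemidef ∧
    ∀ η ξ : Fin n → H, ‖blockForm w η ξ‖ ≤ (scalarForm A η + scalarForm B ξ) / 2

theorem blockForm_add {n : ℕ} (v w : Matrix (Fin n) (Fin n) (H →L[ℂ] H)) (η ξ : Fin n → H) :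
    blockForm (v + w) η ξ = blockForm v η ξ + blockForm w η ξ := by
  simp [blockForm, Finset.sum_add_distrib]

theorem blockForm_smul {n : ℕ} (a : ℂ) (w : Matrix (Fin n) (Fin n) (H →L[ℂ] H))
    (η ξ : Fin n → H) : blockForm (a • w) η ξ = a * blockForm w η ξ := by
  simp [blockForm, Finset.mul_sum]

theorem IsDominated.add {n : ℕ} {v w : Matrix (Fin n) (Fin n) (H →L[ℂ] H)}
    {A B A' B' : Matrix (Fin n) (Fin n) ℂ} (h : IsDominated v A B) (h' : IsDominated w A' B') :
    IsDominated (v + w) (A + A') (B + B') := by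
  refine ⟨h.1.add h'.1, h.2.1.add h'.2.1, fun η ξ => ?_⟩
  rw [blockForm_add, scalarForm_add, scalarForm_add]
  have := norm_add_le (blockForm v η ξ) (blockForm w η ξ)
  linarith [h.2.2 η ξ, h'.2.2 η ξ]

theorem IsDominated.smul {n : ℕ} {w : Matrix (Fin n) (Fin n) (H →L[ℂ] H)}
    {A B : Matrix (Fin n) (Fin n) ℂ} (h : IsDominated w A B) (a : ℂ) :
    IsDominated (a • w) (‖a‖ • A) (‖a‖ • B) := by
  refine ⟨h.1.smul (norm_nonneg a), h.2.1.smul (norm_nonneg a), fun η ξ => ?_⟩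
  rw [blockForm_smul, scalarForm_smul, scalarForm_smul, norm_mul, ← mul_add, mul_div_assoc]
  exact mul_le_mul_of_nonneg_left (h.2.2 η ξ) (norm_nonneg a)

/-- Half of the total trace of a pair of scalar matrices. -/
def halfTrace {n : ℕ} (A B : Matrix (Fin n) (Fin n) ℂ) : ℝ :=
  (A.trace.re + B.trace.re) / 2

theorem halfTrace_nonneg {n : ℕ} {A B : Matrix (Fin n) (Fin n) ℂ} (hA : A.PosSemidef)
    (hB : B.PosSemidef) : 0 ≤ halfTrace A B := by
  have h1 := (Complex.le_def.1 hA.trace_nonneg).1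
  have h2 := (Complex.le_def.1 hB.trace_nonneg).1
  simp only [Complex.zero_re] at h1 h2
  unfold halfTrace
  linarith

/-- The values `(tr A + tr B) / 2` over all pairs `A`, `B` that dominate the amplification of `T`
at `w`. -/
def dominationSet (T : V →ₗ[ℂ] H →L[ℂ] H) {n : ℕ} (w : Matrix (Fin n) (Fin n) V) : Set ℝ :=
  {t | ∃ A B, IsDominated (w.map T) A B ∧ t = halfTrace A B}

theorem isDominated_norm {n : ℕ} (w : Matrix (Fin n) (Fin n) (H →L[ℂ] H)) :
    IsDominated w (‖blockOperator w‖ • 1) (‖blockOperator w‖ • 1) := by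
  have h : 0 ≤ ‖blockOperator w‖ := ContinuousLinearMap.opNorm_nonneg _
  refine ⟨Matrix.PosSemidef.one.smul h, Matrix.PosSemidef.one.smul h, fun η ξ => ?_⟩
  rw [scalarForm_smul, scalarForm_smul, scalarForm_one, scalarForm_one]
  refine (norm_blockForm_le w η ξ).trans (le_of_eq ?_)
  ring

theorem dominationSet_nonempty (T : V →ₗ[ℂ] H →L[ℂ] H) {n : ℕ} (w : Matrix (Fin n) (Fin n) V) :
    (dominationSet T w).Nonempty :=
  ⟨_, _, _, isDominated_norm _, rfl⟩

theorem nonneg_of_mem_dominationSet {T : V →ₗ[ℂ] H →L[ℂ] H} {n : ℕ}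
    {w : Matrix (Fin n) (Fin n) V} {t : ℝ} (ht : t ∈ dominationSet T w) : 0 ≤ t := by
  obtain ⟨A, B, h, rfl⟩ := ht
  exact halfTrace_nonneg h.1 h.2.1

theorem bddBelow_dominationSet (T : V →ₗ[ℂ] H →L[ℂ] H) {n : ℕ} (w : Matrix (Fin n) (Fin n) V) :
    BddBelow (dominationSet T w) :=
  ⟨0, fun _ => nonneg_of_mem_dominationSet⟩

/-- The predual norm on `M_n(V)`: up to its boundary, its unit ball consists of the matrices `αᴴ v
β` with `v` in the unit ball of some `M_m(V)` and `α`, `β` of Hilbert–Schmidt norm at most one.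
Its dual norm is the completely bounded norm of maps `V → M_n`. -/
def predualSeminorm (T : V →ₗ[ℂ] H →L[ℂ] H) (n : ℕ) :
    Seminorm ℂ (Matrix (Fin n) (Fin n) V) :=
  Seminorm.ofSMulLE (fun w => sInf (dominationSet T w))
    (by
      refine le_antisymm (csInf_le (bddBelow_dominationSet T 0) ⟨0, 0, ⟨.zero, .zero, ?_⟩, ?_⟩)
        (le_csInf (dominationSet_nonempty T 0) fun _ => nonneg_of_mem_dominationSet)
      · intro η ξ
        simp [blockForm, scalarForm]
      · simp [halfTrace])
    (by
      intro v w
      rw [← csInf_add (dominationSet_nonempty T v) (bddBelow_dominationSet T v)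
        (dominationSet_nonempty T w) (bddBelow_dominationSet T w)]
      refine csInf_le_csInf (bddBelow_dominationSet T _)
        ((dominationSet_nonempty T v).add (dominationSet_nonempty T w)) ?_
      rintro _ ⟨_, ⟨A, B, h, rfl⟩, _, ⟨A', B', h', rfl⟩, rfl⟩
      refine ⟨A + A', B + B', ?_, ?_⟩
      · have : (v + w).map T = v.map T + w.map T := by ext; simp
        rw [this]
        exact h.add h'
      · simp [halfTrace, Matrix.trace_add]
        ring)
    (by
      intro a w
      have := Real.sInf_smul_of_nonneg (norm_nonneg a) (dominationSet T w)
      rw [smul_eq_mul] at this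
      rw [← this]
      refine csInf_le_csInf (bddBelow_dominationSet T _)
        ((dominationSet_nonempty T w).smul_set) ?_
      rintro _ ⟨_, ⟨A, B, h, rfl⟩, rfl⟩
      refine ⟨‖a‖ • A, ‖a‖ • B, ?_, ?_⟩
      · have : (a • w).map T = a • w.map T := by ext; simp
        rw [this]
        exact h.smul a
      · simp [halfTrace, Matrix.trace_smul]
        ring)

theorem predualSeminorm_le {T : V →ₗ[ℂ] H →L[ℂ] H} {n : ℕ} {w : Matrix (Fin n) (Fin n) V}
    {A B : Matrix (Fin n) (Fin n) ℂ} (h : IsDominated (w.map T) A B) :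
    predualSeminorm T n w ≤ halfTrace A B :=
  csInf_le (bddBelow_dominationSet T w) ⟨A, B, h, rfl⟩

theorem le_predualSeminorm {T : V →ₗ[ℂ] H →L[ℂ] H} {n : ℕ} {w : Matrix (Fin n) (Fin n) V}
    {c : ℝ} (h : ∀ A B, IsDominated (w.map T) A B → c ≤ halfTrace A B) :
    c ≤ predualSeminorm T n w :=
  le_csInf (dominationSet_nonempty T w) fun _ ⟨A, B, hAB, ht⟩ => ht ▸ h A B hAB

theorem scalarForm_basis {n : ℕ} (A : Matrix (Fin n) (Fin n) ℂ) :
    scalarForm A (fun k => EuclideanSpace.single k (1 : ℂ) : Fin n → EuclideanSpace ℂ (Fin n)) =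
      A.trace.re := by
  simp [scalarForm, Matrix.trace, EuclideanSpace.inner_single_left]

/-- A positive semidefinite matrix, made definite, factors as `aᴴ a` with `a` invertible. -/
theorem exists_conjTranspose_mul_self_add {n : ℕ} {A : Matrix (Fin n) (Fin n) ℂ}
    (hA : A.PosSemidef) {ε : ℝ} (hε : 0 < ε) :
    ∃ a b : Matrix (Fin n) (Fin n) ℂ, a.conjTranspose * a = A + ε • 1 ∧ a * b = 1 ∧ b * a = 1 := by
  have hpos : (A + ε • 1).PosDef :=
    Matrix.PosDef.posSemidef_add hA (Matrix.PosDef.one.smul hε)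
  open scoped MatrixOrder in
  obtain ⟨a, ha⟩ := CStarAlgebra.nonneg_iff_eq_star_mul_self.1 hpos.posSemidef.nonneg
  rw [Matrix.star_eq_conjTranspose] at ha
  have hu : IsUnit a.det := by
    have h1 := (Matrix.isUnit_iff_isUnit_det _).1 hpos.isUnit
    rw [ha, Matrix.det_mul] at h1
    exact isUnit_of_mul_isUnit_right h1
  exact ⟨a, a⁻¹, ha.symm, Matrix.mul_nonsing_inv a hu, Matrix.nonsing_inv_mul a hu⟩

/-- A linear map into `M_n` that is completely contractive with respect to `T` pairs contractively
with the predual norm. -/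
theorem norm_blockForm_basis_le {W : Type*} [AddCommGroup W] [Module ℂ W]
    (T : W →ₗ[ℂ] H →L[ℂ] H) {n : ℕ}
    (φ : W →ₗ[ℂ] EuclideanSpace ℂ (Fin n) →L[ℂ] EuclideanSpace ℂ (Fin n))
    (hφ : ∀ (m : ℕ) (v : Matrix (Fin m) (Fin m) W), ampNorm φ v ≤ ampNorm T v)
    (w : Matrix (Fin n) (Fin n) W) {A B : Matrix (Fin n) (Fin n) ℂ}
    (h : IsDominated (w.map T) A B) :
    ‖blockForm (w.map φ) (fun k => EuclideanSpace.single k 1)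
      (fun k => EuclideanSpace.single k 1)‖ ≤ halfTrace A B := by
  refine le_of_forall_pos_le_add fun ε hε => ?_
  -- `A` and `B` are made invertible at the cost of a small increase of their traces
  obtain ⟨r, hr, hrn⟩ : ∃ r : ℝ, 0 < r ∧ r * n ≤ ε :=
    ⟨ε / (n + 1), by positivity, by
      rw [div_mul_eq_mul_div, div_le_iff₀ (by positivity)]; nlinarith⟩
  obtain ⟨a, a', ha, haa, haa'⟩ := exists_conjTranspose_mul_self_add h.1 hr
  obtain ⟨b, b', hb, hbb, hbb'⟩ := exists_conjTranspose_mul_self_add h.2.1 hr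
  set v := compression a' b' w with hv
  have hT : ampNorm T v ≤ 1 := by
    refine norm_blockOperator_le zero_le_one fun η ξ => ?_
    rw [hv, compression_map, blockForm_compression]
    refine (h.2.2 _ _).trans ?_
    have h1 : scalarForm A (scalarAct a' η) ≤ ∑ i, ‖η i‖ ^ 2 := by
      have := scalarForm_conjTranspose_mul_self a (scalarAct a' η)
      rw [scalarAct_scalarAct, haa, scalarAct_one, ha, scalarForm_add, scalarForm_smul,
        scalarForm_one] at this
      rw [← this]
      have : 0 ≤ r * ∑ i, ‖scalarAct a' η i‖ ^ 2 := by positivity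
      linarith
    have h2 : scalarForm B (scalarAct b' ξ) ≤ ∑ i, ‖ξ i‖ ^ 2 := by
      have := scalarForm_conjTranspose_mul_self b (scalarAct b' ξ)
      rw [scalarAct_scalarAct, hbb, scalarAct_one, hb, scalarForm_add, scalarForm_smul,
        scalarForm_one] at this
      rw [← this]
      have : 0 ≤ r * ∑ i, ‖scalarAct b' ξ i‖ ^ 2 := by positivity
      linarith
    linarith
  have hw : w = compression a b v := by
    rw [hv, compression_compression, haa', hbb', compression_one]
  have hφv : ‖blockOperator (v.map φ)‖ ≤ 1 := (hφ n v).trans hT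
  rw [hw, compression_map, blockForm_compression]
  refine (norm_blockForm_le _ _ _).trans ?_
  rw [← scalarForm_conjTranspose_mul_self, ← scalarForm_conjTranspose_mul_self, ha, hb,
    scalarForm_basis, scalarForm_basis]
  have htr : ∀ C : Matrix (Fin n) (Fin n) ℂ, (C + r • 1).trace.re = C.trace.re + r * n := by
    intro C; simp [Matrix.trace_add, Matrix.trace_smul]
  have h0 : 0 ≤ (A + r • 1).trace.re + (B + r • 1).trace.re := by
    rw [← ha, ← hb, ← scalarForm_basis, ← scalarForm_basis, scalarForm_conjTranspose_mul_self,
      scalarForm_conjTranspose_mul_self]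
    positivity
  rw [htr, htr] at h0 ⊢
  have := mul_le_mul_of_nonneg_right hφv h0
  unfold halfTrace
  linarith

/-- The map `V → M_n` corresponding to a functional on `M_n(V)`. -/
def ofFunctional {n : ℕ} (S : Matrix (Fin n) (Fin n) V →ₗ[ℂ] ℂ) :
    V →ₗ[ℂ] EuclideanSpace ℂ (Fin n) →L[ℂ] EuclideanSpace ℂ (Fin n) where
  toFun v := Matrix.toEuclideanCLM (𝕜 := ℂ) (Matrix.of fun k l => S (Matrix.single k l v))
  map_add' v w := by
    rw [← map_add]
    congr 1
    ext k l
    simp [Matrix.single_add]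
  map_smul' a v := by
    rw [RingHom.id_apply, ← map_smul]
    congr 1
    ext k l
    simp [← Matrix.smul_single]

theorem ofFunctional_apply {n : ℕ} (S : Matrix (Fin n) (Fin n) V →ₗ[ℂ] ℂ) (v : V)
    (ξ : EuclideanSpace ℂ (Fin n)) (k : Fin n) :
    ofFunctional S v ξ k = ∑ l, S (Matrix.single k l v) * ξ l := by
  simp [ofFunctional, Matrix.mulVec, dotProduct]

/-- The forms of the amplifications of `ofFunctional S` are the values of `S` at compressions. -/
theorem blockForm_ofFunctional {m n : ℕ} (S : Matrix (Fin n) (Fin n) V →ₗ[ℂ] ℂ)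
    (v : Matrix (Fin m) (Fin m) V) (η ξ : Fin m → EuclideanSpace ℂ (Fin n)) :
    blockForm (v.map (ofFunctional S)) η ξ =
      S (compression (Matrix.of fun i k => η i k) (Matrix.of fun j l => ξ j l) v) := by
  have h : compression (Matrix.of fun i k => η i k) (Matrix.of fun j l => ξ j l) v =
      ∑ i, ∑ j, ∑ k, ∑ l, (conj (η i k) * ξ j l) • Matrix.single k l (v i j) := by
    ext k l
    simp only [compression, Matrix.sum_apply, Matrix.smul_apply, Matrix.of_apply]
    refine Finset.sum_congr rfl fun i _ => Finset.sum_congr rfl fun j _ => ?_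
    rw [Finset.sum_eq_single k, Finset.sum_eq_single l]
    · simp
    · intro l' _ hl'; simp [hl']
    · simp
    · intro k' _ hk'; simp [hk']
    · simp
  rw [h]
  simp only [map_sum, map_smul, blockForm, PiLp.inner_apply, Matrix.map_apply,
    ofFunctional_apply, RCLike.inner_apply, smul_eq_mul, Finset.sum_mul]
  refine Finset.sum_congr rfl fun i _ => Finset.sum_congr rfl fun j _ =>
    Finset.sum_congr rfl fun k _ => Finset.sum_congr rfl fun l _ => ?_
  ring

/-- Functionals that are contractive for the predual norm are complete contractions. -/
theorem ampNorm_ofFunctional_le {T : V →ₗ[ℂ] H →L[ℂ] H} {n : ℕ}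
    {S : Matrix (Fin n) (Fin n) V →ₗ[ℂ] ℂ} (hS : ∀ w, ‖S w‖ ≤ predualSeminorm T n w)
    {m : ℕ} (v : Matrix (Fin m) (Fin m) V) : ampNorm (ofFunctional S) v ≤ ampNorm T v := by
  refine norm_blockOperator_le (ampNorm_nonneg T v) fun η ξ => ?_
  rw [blockForm_ofFunctional]
  set α : Matrix (Fin m) (Fin n) ℂ := Matrix.of fun i k => η i k
  set β : Matrix (Fin m) (Fin n) ℂ := Matrix.of fun j l => ξ j l
  have hc := ampNorm_nonneg T v
  have hdom : IsDominated ((compression α β v).map T) (ampNorm T v • (α.conjTranspose * α))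
      (ampNorm T v • (β.conjTranspose * β)) := by
    refine ⟨(Matrix.posSemidef_conjTranspose_mul_self α).smul hc,
      (Matrix.posSemidef_conjTranspose_mul_self β).smul hc, fun x y => ?_⟩
    rw [compression_map, blockForm_compression, scalarForm_smul, scalarForm_smul,
      scalarForm_conjTranspose_mul_self, scalarForm_conjTranspose_mul_self]
    refine (norm_blockForm_le _ _ _).trans (le_of_eq ?_)
    simp only [ampNorm]
    ring
  have htr : ∀ ζ : Fin m → EuclideanSpace ℂ (Fin n),
      ((Matrix.of fun i k => ζ i k).conjTranspose *
        (Matrix.of fun i k => ζ i k : Matrix (Fin m) (Fin n) ℂ)).trace.re = ∑ i, ‖ζ i‖ ^ 2 := by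
    intro ζ
    simp only [Matrix.trace, Matrix.diag_apply, Matrix.mul_apply, Matrix.conjTranspose_apply,
      Matrix.of_apply, EuclideanSpace.norm_sq_eq, Complex.re_sum]
    rw [Finset.sum_comm]
    refine Finset.sum_congr rfl fun i _ => Finset.sum_congr rfl fun k _ => ?_
    rw [← Complex.normSq_eq_norm_sq, Complex.star_def, ← Complex.normSq_eq_conj_mul_self,
      Complex.ofReal_re]
  refine ((hS _).trans (predualSeminorm_le hdom)).trans (le_of_eq ?_)
  simp only [halfTrace, Matrix.trace_smul, Complex.real_smul, Complex.re_ofReal_mul]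
  rw [htr, htr]
  ring

/-- **Extension of complete contractions into `M_n`.** Complete contractions into `M_n` extend
from a subspace, here the image of the injective map `ι`. -/
theorem exists_extension {E : Type*} [AddCommGroup E] [Module ℂ E] (T : V →ₗ[ℂ] H →L[ℂ] H)
    (ι : E →ₗ[ℂ] V) (hι : Function.Injective ι) {n : ℕ}
    (φ : E →ₗ[ℂ] EuclideanSpace ℂ (Fin n) →L[ℂ] EuclideanSpace ℂ (Fin n))
    (hφ : ∀ (m : ℕ) (v : Matrix (Fin m) (Fin m) E), ampNorm φ v ≤ ampNorm (T ∘ₗ ι) v) :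
    ∃ Φ : V →ₗ[ℂ] EuclideanSpace ℂ (Fin n) →L[ℂ] EuclideanSpace ℂ (Fin n),
      Φ ∘ₗ ι = φ ∧ ∀ (m : ℕ) (v : Matrix (Fin m) (Fin m) V), ampNorm Φ v ≤ ampNorm T v := by
  obtain ⟨g, hg⟩ := ι.exists_leftInverse_of_injective (LinearMap.ker_eq_bot.2 hι)
  have hgι : ∀ x, g (ι x) = x := fun x => LinearMap.congr_fun hg x
  let J : Matrix (Fin n) (Fin n) E →ₗ[ℂ] Matrix (Fin n) (Fin n) V := ι.mapMatrix
  let e : Fin n → EuclideanSpace ℂ (Fin n) := fun k => EuclideanSpace.single k 1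
  let s : Matrix (Fin n) (Fin n) V →ₗ[ℂ] ℂ :=
    { toFun := fun w => blockForm (w.map (φ ∘ₗ g)) e e
      map_add' := fun v w => by
        rw [← blockForm_add]; congr 1; ext; simp
      map_smul' := fun a w => by
        rw [RingHom.id_apply, smul_eq_mul, ← blockForm_smul]; congr 1; ext; simp }
  have hs : ∀ w, s (J w) = blockForm (w.map φ) e e := by
    intro w
    change blockForm ((w.map ι).map (φ ∘ₗ g)) e e = _
    congr 1
    ext1 k l
    simp [hgι]
  obtain ⟨S, hS, hSp⟩ := Module.Dual.exists_extension_of_le_seminorm (LinearMap.range J)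
    (s.domRestrict _) (p := predualSeminorm T n) (by
      rintro ⟨_, w, rfl⟩
      change ‖s (J w)‖ ≤ predualSeminorm T n (J w)
      rw [hs]
      refine le_predualSeminorm fun A B hAB => ?_
      refine norm_blockForm_basis_le (T ∘ₗ ι) φ hφ w ?_
      have : (J w).map T = w.map (T ∘ₗ ι) := by ext1 k l; simp [J]
      rwa [this] at hAB)
  refine ⟨ofFunctional S, ?_, fun m v => ampNorm_ofFunctional_le hSp v⟩
  ext x ξ k
  rw [LinearMap.comp_apply, ofFunctional_apply]
  have h1 : ∀ l, S (Matrix.single k l (ι x)) = φ x (EuclideanSpace.single l 1) k := by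
    intro l
    have h2 : Matrix.single k l (ι x) = J (Matrix.single k l x) := by
      ext i j
      simp only [J, LinearMap.mapMatrix_apply, Matrix.map_apply, Matrix.single_apply]
      split_ifs <;> simp
    have h3 := hS ⟨J (Matrix.single k l x), ⟨_, rfl⟩⟩
    rw [h2]
    refine h3.trans ((hs _).trans ?_)
    rw [blockForm, Finset.sum_eq_single k, Finset.sum_eq_single l]
    · simp [e, EuclideanSpace.inner_single_left]
    · intro j _ hj
      simp [hj.symm]
    · simp
    · intro i _ hi
      refine Finset.sum_eq_zero fun j _ => ?_
      simp [hi.symm]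
    · simp
  simp only [h1]
  have hξ : ξ = ∑ l, ξ l • EuclideanSpace.single l (1 : ℂ) := by
    ext k
    simp [Pi.single_apply]
  conv_rhs => rw [hξ]
  simp [mul_comm]

end Wittstock

end OperatorSpace

end

/-! ### Block diagonal direct sums -/

noncomputable section

namespace OperatorSpace

open scoped InnerProductSpace

section DirectSum

theorem hasSum_norm_sq {I : Type*} {E : I → Type*} [∀ i, NormedAddCommGroup (E i)]
    (x : lp E 2) : HasSum (fun i => ‖x i‖ ^ 2) (‖x‖ ^ 2) := by
  have := lp.hasSum_norm (p := 2) (by simp) x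
  simpa using this

variable {V : Type*} [AddCommGroup V] [Module ℂ V]
  {I : Type*} {E : I → Type*} [∀ i, NormedAddCommGroup (E i)] [∀ i, InnerProductSpace ℂ (E i)]

/-- The block diagonal direct sum, on the Hilbert space direct sum of the `E i`, of a pointwise
bounded family of linear maps into the spaces `B(E i)`. -/
def diagSum (T : ∀ i, V →ₗ[ℂ] E i →L[ℂ] E i) (hT : ∀ v, ∃ K : ℝ, 0 ≤ K ∧ ∀ i, ‖T i v‖ ≤ K) :
    V →ₗ[ℂ] lp E 2 →L[ℂ] lp E 2 where
  toFun v := lp.mapCLM 2 (fun i => T i v) (hT v).choose_spec.1 (hT v).choose_spec.2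
  map_add' v w := by ext; simp
  map_smul' a v := by ext; simp

theorem diagSum_apply (T : ∀ i, V →ₗ[ℂ] E i →L[ℂ] E i)
    (hT : ∀ v, ∃ K : ℝ, 0 ≤ K ∧ ∀ i, ‖T i v‖ ≤ K) (v : V) (x : lp E 2) (i : I) :
    diagSum T hT v x i = T i v (x i) := rfl

theorem ampNorm_diagSum_le {T : ∀ i, V →ₗ[ℂ] E i →L[ℂ] E i}
    (hT : ∀ v, ∃ K : ℝ, 0 ≤ K ∧ ∀ i, ‖T i v‖ ≤ K) {n : ℕ} {v : Matrix (Fin n) (Fin n) V} {c : ℝ}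
    (hc : 0 ≤ c) (h : ∀ i, ampNorm (T i) v ≤ c) : ampNorm (diagSum T hT) v ≤ c := by
  refine norm_blockOperator_le hc fun η ξ => ?_
  have h1 : HasSum (fun k => blockForm (v.map (T k)) (fun i => η i k) (fun j => ξ j k))
      (blockForm (v.map (diagSum T hT)) η ξ) :=
    hasSum_sum fun i _ => hasSum_sum fun j _ => lp.hasSum_inner (η i) (diagSum T hT (v i j) (ξ j))
  have h2 : HasSum (fun k => c / 2 * (∑ i, ‖η i k‖ ^ 2 + ∑ i, ‖ξ i k‖ ^ 2))
      (c / 2 * (∑ i, ‖η i‖ ^ 2 + ∑ i, ‖ξ i‖ ^ 2)) :=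
    ((hasSum_sum fun i _ => hasSum_norm_sq (η i)).add
      (hasSum_sum fun i _ => hasSum_norm_sq (ξ i))).mul_left _
  rw [← h1.tsum_eq]
  refine tsum_of_norm_bounded h2 fun k => (norm_blockForm_le _ _ _).trans ?_
  have := h k
  unfold ampNorm at this
  gcongr

theorem ampNorm_le_diagSum (T : ∀ i, V →ₗ[ℂ] E i →L[ℂ] E i)
    (hT : ∀ v, ∃ K : ℝ, 0 ≤ K ∧ ∀ i, ‖T i v‖ ≤ K) (k : I) {n : ℕ}
    (v : Matrix (Fin n) (Fin n) V) : ampNorm (T k) v ≤ ampNorm (diagSum T hT) v := by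
  classical
  refine norm_blockOperator_le (ampNorm_nonneg _ v) fun η ξ => ?_
  have h := norm_blockForm_le (v.map (diagSum T hT)) (fun i => lp.single 2 k (η i))
    (fun i => lp.single 2 k (ξ i))
  have h1 : blockForm (v.map (diagSum T hT)) (fun i => lp.single 2 k (η i))
      (fun i => lp.single 2 k (ξ i)) = blockForm (v.map (T k)) η ξ := by
    refine Finset.sum_congr rfl fun i _ => Finset.sum_congr rfl fun j _ => ?_
    rw [lp.inner_single_left, Matrix.map_apply, diagSum_apply, lp.single_apply_self,
      Matrix.map_apply]
  have h2 : ∀ x : E k, ‖(lp.single 2 k x : lp E 2)‖ = ‖x‖ := fun x =>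
    lp.norm_single (by simp) k x
  simpa only [ampNorm, h1, h2] using h

variable {H K : Type*} [NormedAddCommGroup H] [InnerProductSpace ℂ H]
  [NormedAddCommGroup K] [InnerProductSpace ℂ K]

/-- Conjugation of a map into `B(H)` by a unitary `H → K`. -/
def conjUnitary (U : H ≃ₗᵢ[ℂ] K) (T : V →ₗ[ℂ] H →L[ℂ] H) : V →ₗ[ℂ] K →L[ℂ] K where
  toFun v := (U.toContinuousLinearEquiv : H →L[ℂ] K) ∘L T v ∘L
    (U.symm.toContinuousLinearEquiv : K →L[ℂ] H)
  map_add' v w := by ext; simp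
  map_smul' a v := by ext; simp

theorem ampNorm_conjUnitary (U : H ≃ₗᵢ[ℂ] K) (T : V →ₗ[ℂ] H →L[ℂ] H) {n : ℕ}
    (v : Matrix (Fin n) (Fin n) V) : ampNorm (conjUnitary U T) v = ampNorm T v := by
  have key : ∀ η ξ : Fin n → H, blockForm (v.map (conjUnitary U T)) (fun i => U (η i))
      (fun i => U (ξ i)) = blockForm (v.map T) η ξ := by
    intro η ξ
    simp [blockForm, conjUnitary]
  refine le_antisymm (norm_blockOperator_le (ampNorm_nonneg _ v) fun η ξ => ?_)
    (norm_blockOperator_le (ampNorm_nonneg _ v) fun η ξ => ?_)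
  · have h := norm_blockForm_le (v.map T) (fun i => U.symm (η i)) (fun i => U.symm (ξ i))
    rw [← key] at h
    simpa [ampNorm] using h
  · have h := norm_blockForm_le (v.map (conjUnitary U T)) (fun i => U (η i)) (fun i => U (ξ i))
    rw [key] at h
    simpa [ampNorm] using h

/-- A linear map from `V` into the matrices of some finite size. -/
abbrev MatrixMap (V : Type*) [AddCommGroup V] [Module ℂ V] : Type _ :=
  Σ r : ℕ, V →ₗ[ℂ] EuclideanSpace ℂ (Fin r) →L[ℂ] EuclideanSpace ℂ (Fin r)

/-- A sequence of maps into matrices has a direct sum on a Hilbert space, whose amplified seminorms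
are the suprema of theirs. -/
theorem exists_directSum (R : ℕ → MatrixMap V)
    (hR : ∀ v, ∃ K : ℝ, 0 ≤ K ∧ ∀ k, ‖(R k).2 v‖ ≤ K) :
    ∃ (K : Type) (_ : NormedAddCommGroup K) (_ : InnerProductSpace ℂ K) (_ : CompleteSpace K)
      (T : V →ₗ[ℂ] K →L[ℂ] K), ∀ (n : ℕ) (v : Matrix (Fin n) (Fin n) V),
        (∀ k, ampNorm (R k).2 v ≤ ampNorm T v) ∧
        ∀ c : ℝ, 0 ≤ c → (∀ k, ampNorm (R k).2 v ≤ c) → ampNorm T v ≤ c :=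
  ⟨lp (fun k => EuclideanSpace ℂ (Fin (R k).1)) 2, inferInstance, inferInstance, inferInstance,
    diagSum (fun k => (R k).2) hR, fun _ v =>
      ⟨fun k => ampNorm_le_diagSum (fun k => (R k).2) hR k v,
        fun _ hc h => ampNorm_diagSum_le hR hc h⟩⟩

/-- The direct sum of two maps into matrices is a map into matrices. -/
theorem exists_ampNorm_eq_max {r s : ℕ}
    (R : V →ₗ[ℂ] EuclideanSpace ℂ (Fin r) →L[ℂ] EuclideanSpace ℂ (Fin r))
    (S : V →ₗ[ℂ] EuclideanSpace ℂ (Fin s) →L[ℂ] EuclideanSpace ℂ (Fin s)) :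
    ∃ T : MatrixMap V, ∀ (n : ℕ) (v : Matrix (Fin n) (Fin n) V),
      ampNorm T.2 v = max (ampNorm R v) (ampNorm S v) := by
  let P : Bool → MatrixMap V := fun b => bif b then ⟨r, R⟩ else ⟨s, S⟩
  have hP : ∀ v, ∃ K : ℝ, 0 ≤ K ∧ ∀ b, ‖(P b).2 v‖ ≤ K := fun v =>
    ⟨∑ b, ‖(P b).2 v‖, by positivity, fun b =>
      Finset.single_le_sum (f := fun b => ‖(P b).2 v‖) (fun _ _ => norm_nonneg _)
        (Finset.mem_univ b)⟩
  let K := lp (fun b => EuclideanSpace ℂ (Fin (P b).1)) 2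
  have : FiniteDimensional ℂ K :=
    (lpPiLpₗᵢ (fun b => EuclideanSpace ℂ (Fin (P b).1))
      ℂ).symm.toLinearEquiv.finiteDimensional
  let U : K ≃ₗᵢ[ℂ] EuclideanSpace ℂ (Fin (Module.finrank ℂ K)) :=
    (stdOrthonormalBasis ℂ K).repr
  refine ⟨⟨_, conjUnitary U (diagSum (fun b => (P b).2) hP)⟩, fun n v => ?_⟩
  rw [ampNorm_conjUnitary]
  refine le_antisymm (ampNorm_diagSum_le hP (le_max_of_le_left (ampNorm_nonneg R v)) fun b => ?_)
    (max_le (ampNorm_le_diagSum (fun b => (P b).2) hP true v)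
      (ampNorm_le_diagSum (fun b => (P b).2) hP false v))
  cases b
  · exact le_max_right _ _
  · exact le_max_left _ _

end DirectSum

end OperatorSpace

end

/-! ### Completely bounded norms and `1`-exactness -/

noncomputable section

namespace OperatorSpace

section Exactness

variable {H K : Type*}
  [NormedAddCommGroup H] [InnerProductSpace ℂ H]
  [NormedAddCommGroup K] [InnerProductSpace ℂ K]

theorem matNorm_eq_ampNorm {X : Submodule ℂ (H →L[ℂ] H)} {n : ℕ} (x : Matrix (Fin n) (Fin n) X) :
    matNorm x = ampNorm X.subtype x := rfl

theorem matNorm_map {X : Submodule ℂ (H →L[ℂ] H)} {V : Type*} [AddCommGroup V] [Module ℂ V]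
    (φ : V →ₗ[ℂ] X) {n : ℕ} (v : Matrix (Fin n) (Fin n) V) :
    matNorm (v.map φ) = ampNorm (X.subtype ∘ₗ φ) v :=
  ampNorm_map X.subtype φ v

theorem matNorm_map_rangeRestrict {U V : Type*} [AddCommGroup U] [Module ℂ U] [AddCommGroup V]
    [Module ℂ V] (T : V →ₗ[ℂ] H →L[ℂ] H) (g : U →ₗ[ℂ] V) {n : ℕ} (u : Matrix (Fin n) (Fin n) U) :
    matNorm (u.map (T.rangeRestrict ∘ₗ g)) = ampNorm T (u.map g) := rfl

theorem cbNorm_le {X : Submodule ℂ (H →L[ℂ] H)} {Y : Submodule ℂ (K →L[ℂ] K)} {φ : X →ₗ[ℂ] Y}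
    {c : ℝ} (hc : 0 ≤ c)
    (h : ∀ (n : ℕ) (x : Matrix (Fin n) (Fin n) X), matNorm (x.map φ) ≤ c * matNorm x) :
    cbNorm φ ≤ ENNReal.ofReal c :=
  iSup_le fun n => iSup_le fun x => iSup_le fun hx =>
    ENNReal.ofReal_le_ofReal ((h n x).trans (mul_le_of_le_one_right hc hx))

theorem matNorm_map_le {X : Submodule ℂ (H →L[ℂ] H)} {Y : Submodule ℂ (K →L[ℂ] K)}
    {φ : X →ₗ[ℂ] Y} {c : ℝ} (hc : 0 ≤ c) (h : cbNorm φ ≤ ENNReal.ofReal c) {n : ℕ}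
    (x : Matrix (Fin n) (Fin n) X) : matNorm (x.map φ) ≤ c * matNorm x := by
  have h1 : ∀ y : Matrix (Fin n) (Fin n) X, matNorm y ≤ 1 → matNorm (y.map φ) ≤ c := by
    intro y hy
    have := (le_iSup_of_le n (le_iSup_of_le y (le_iSup_of_le hy le_rfl)) :
      ENNReal.ofReal (matNorm (y.map φ)) ≤ cbNorm φ).trans h
    exact (ENNReal.ofReal_le_ofReal_iff hc).1 this
  have hx : 0 ≤ matNorm x := ampNorm_nonneg X.subtype x
  -- a small summand covers matrices of norm zero
  refine le_of_forall_pos_le_add fun ε hε => ?_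
  obtain ⟨r, hr, hrc⟩ : ∃ r : ℝ, 0 < r ∧ c * r ≤ ε :=
    ⟨ε / (c + 1), by positivity, by
      rw [mul_div_assoc', div_le_iff₀ (by positivity)]; nlinarith⟩
  have hs : 0 < matNorm x + r := by positivity
  have ha : ‖((matNorm x + r : ℝ) : ℂ)⁻¹‖ = (matNorm x + r)⁻¹ := by
    rw [norm_inv, Complex.norm_real, Real.norm_of_nonneg hs.le]
  have h2 := h1 (((matNorm x + r : ℝ) : ℂ)⁻¹ • x) (by
    rw [matNorm_eq_ampNorm, ampNorm_apply_smul, ha, inv_mul_le_iff₀ hs, mul_one,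
      ← matNorm_eq_ampNorm]
    linarith)
  rw [matNorm_map, ampNorm_apply_smul, ha, inv_mul_le_iff₀ hs, ← matNorm_map] at h2
  linarith

theorem cbNorm_ne_zero {X : Submodule ℂ (H →L[ℂ] H)} {Y : Submodule ℂ (K →L[ℂ] K)}
    [Nontrivial X] (e : X ≃ₗ[ℂ] Y) : cbNorm e.toLinearMap ≠ 0 := by
  intro h
  obtain ⟨x, hx⟩ := exists_ne (0 : X)
  have h2 := matNorm_map_le (φ := e.toLinearMap) (c := 0) le_rfl (by simp [h])
    (Matrix.of fun _ _ : Fin 1 => x)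
  rw [zero_mul, matNorm_map] at h2
  have h3 := eq_zero_of_ampNorm_eq_zero _ (le_antisymm h2 (ampNorm_nonneg _ _))
  exact hx (e.map_eq_zero_iff.1 (Subtype.ext h3))

/-- A finite-dimensional `1`-exact space embeds into matrices up to an arbitrarily small
distortion. -/
theorem IsOneExact.exists_matrixMap {X : Submodule ℂ (H →L[ℂ] H)} [FiniteDimensional ℂ X]
    (hX : IsOneExact X) {η : ℝ} (hη : 0 < η) :
    ∃ φ : MatrixMap X, ∀ (n : ℕ) (v : Matrix (Fin n) (Fin n) X),
      ampNorm φ.2 v ≤ matNorm v ∧ matNorm v ≤ (1 + η) * ampNorm φ.2 v := by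
  rcases subsingleton_or_nontrivial X with hsub | hnt
  · -- for the zero space, a product `0 * ∞` of norms carries no information
    refine ⟨⟨0, 0⟩, fun n v => ?_⟩
    have hv : v = 0 := by ext1 i j; exact Subsingleton.elim _ _
    rw [matNorm_eq_ampNorm, ampNorm_eq_zero (by rw [hv]; ext1; simp),
      ampNorm_eq_zero (by rw [hv]; ext1; simp)]
    simp
  have h1 : exactnessConstantFin X < ENNReal.ofReal (1 + η) := by
    have hle : exactnessConstantFin X ≤ exactnessConstant X :=
      le_iSup₂_of_le X le_rfl
        (le_iSup (fun _ : FiniteDimensional ℂ X => exactnessConstantFin X) inferInstance)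
    refine lt_of_le_of_lt (hle.trans hX) ?_
    rw [← ENNReal.ofReal_one]
    exact (ENNReal.ofReal_lt_ofReal_iff (by linarith)).2 (by linarith)
  simp only [exactnessConstantFin, cbDist, iInf_lt_iff] at h1
  obtain ⟨r, F, φ, h1⟩ := h1
  have hnt' : Nontrivial F := φ.symm.toEquiv.nontrivial
  have ha0 := cbNorm_ne_zero φ
  have hb0 := cbNorm_ne_zero φ.symm
  have hfin : cbNorm φ.toLinearMap * cbNorm φ.symm.toLinearMap ≠ ⊤ := (h1.trans_le le_top).ne
  have hat : cbNorm φ.toLinearMap ≠ ⊤ := fun h => hfin (by rw [h, ENNReal.top_mul hb0])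
  have hbt : cbNorm φ.symm.toLinearMap ≠ ⊤ := fun h => hfin (by rw [h, ENNReal.mul_top ha0])
  set a := (cbNorm φ.toLinearMap).toReal with ha
  set b := (cbNorm φ.symm.toLinearMap).toReal with hb
  have hapos : 0 < a := ENNReal.toReal_pos ha0 hat
  have hbpos : 0 < b := ENNReal.toReal_pos hb0 hbt
  have hab : a * b ≤ 1 + η := by
    have := ENNReal.toReal_mono ENNReal.ofReal_ne_top h1.le
    rwa [ENNReal.toReal_mul, ENNReal.toReal_ofReal (by linarith)] at this
  have hna : ‖((a : ℝ) : ℂ)⁻¹‖ = a⁻¹ := by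
    rw [norm_inv, Complex.norm_real, Real.norm_of_nonneg hapos.le]
  refine ⟨⟨r, (a : ℂ)⁻¹ • (F.subtype ∘ₗ φ.toLinearMap)⟩, fun n v => ?_⟩
  have h2 := matNorm_map_le hapos.le (φ := φ.toLinearMap) (ENNReal.ofReal_toReal hat).ge v
  have h3 := matNorm_map_le hbpos.le (φ := φ.symm.toLinearMap) (ENNReal.ofReal_toReal hbt).ge
    (v.map φ.toLinearMap)
  have h4 : (v.map φ.toLinearMap).map φ.symm.toLinearMap = v := by ext1; simp
  rw [h4] at h3
  have hN := ampNorm_nonneg (F.subtype ∘ₗ φ.toLinearMap) v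
  simp only [ampNorm_smul, hna]
  rw [matNorm_map] at h2 h3
  refine ⟨by rwa [inv_mul_le_iff₀ hapos], h3.trans ?_⟩
  have : b ≤ (1 + η) * a⁻¹ := by rwa [← div_eq_mul_inv, le_div_iff₀ hapos, mul_comm]
  rw [← mul_assoc]
  exact mul_le_mul_of_nonneg_right this hN

theorem exactnessConstantFin_le_one {E : Submodule ℂ (H →L[ℂ] H)}
    (h : ∀ η : ℝ, 0 < η → ∃ φ : MatrixMap E, ∀ (n : ℕ) (v : Matrix (Fin n) (Fin n) E),
      ampNorm φ.2 v ≤ matNorm v ∧ matNorm v ≤ (1 + η) * ampNorm φ.2 v) :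
    exactnessConstantFin E ≤ 1 := by
  refine ENNReal.le_of_forall_pos_le_add fun η hη _ => ?_
  obtain ⟨⟨r, φ⟩, hφ⟩ := h η hη
  have hinj : Function.Injective φ := by
    refine (injective_iff_map_eq_zero φ).2 fun x hx => ?_
    have h1 := (hφ 1 (Matrix.of fun _ _ => x)).2
    have h2 : ampNorm φ (Matrix.of fun _ _ : Fin 1 => x) = 0 :=
      ampNorm_eq_zero (by ext1; simpa using hx)
    simp only at h1
    rw [h2, mul_zero] at h1
    have h3 := eq_zero_of_ampNorm_eq_zero E.subtype
      (le_antisymm h1 (ampNorm_nonneg E.subtype _))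
    simpa using h3
  let e := LinearEquiv.ofInjective φ hinj
  have he : ∀ (n : ℕ) (v : Matrix (Fin n) (Fin n) E), matNorm (v.map e.toLinearMap) =
      ampNorm φ v := fun n v => matNorm_map e.toLinearMap v
  have h1 : cbNorm e.toLinearMap ≤ ENNReal.ofReal 1 :=
    cbNorm_le zero_le_one fun n v => by rw [he, one_mul]; exact (hφ n v).1
  have h2 : cbNorm e.symm.toLinearMap ≤ ENNReal.ofReal (1 + η) := by
    refine cbNorm_le (by positivity) fun n v => ?_
    have := (hφ n (v.map e.symm.toLinearMap)).2
    have h4 : (v.map e.symm.toLinearMap).map e.toLinearMap = v := by ext1; simp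
    simp only at this
    rwa [← he, h4] at this
  calc exactnessConstantFin E ≤ cbDist E (LinearMap.range φ) := iInf_le_of_le r (iInf_le _ _)
    _ ≤ cbNorm e.toLinearMap * cbNorm e.symm.toLinearMap := iInf_le _ e
    _ ≤ ENNReal.ofReal 1 * ENNReal.ofReal (1 + η) := mul_le_mul' h1 h2
    _ = 1 + η := by
      rw [ENNReal.ofReal_one, one_mul, ENNReal.ofReal_add zero_le_one η.coe_nonneg]
      simp

/-- If a matricial seminorm on `W` is, up to an arbitrarily small distortion, that of a map into
matrices, then the space that realizes it is `1`-exact. -/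
theorem isOneExact_range {W : Type*} [AddCommGroup W] [Module ℂ W] (T : W →ₗ[ℂ] H →L[ℂ] H)
    (hinj : Function.Injective T)
    (h : ∀ η : ℝ, 0 < η → ∃ φ : MatrixMap W, ∀ (n : ℕ) (v : Matrix (Fin n) (Fin n) W),
      ampNorm φ.2 v ≤ ampNorm T v ∧ ampNorm T v ≤ (1 + η) * ampNorm φ.2 v) :
    IsOneExact (LinearMap.range T) := by
  refine iSup_le fun E => iSup_le fun hE => iSup_le fun _ =>
    exactnessConstantFin_le_one fun η hη => ?_
  obtain ⟨⟨r, φ⟩, hφ⟩ := h η hη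
  let g : E →ₗ[ℂ] W := (LinearEquiv.ofInjective T hinj).symm.toLinearMap ∘ₗ Submodule.inclusion hE
  have hg : T ∘ₗ g = E.subtype := by
    ext1 x
    exact congrArg Subtype.val
      ((LinearEquiv.ofInjective T hinj).apply_symm_apply (Submodule.inclusion hE x))
  refine ⟨⟨r, φ ∘ₗ g⟩, fun n v => ?_⟩
  have := hφ n (v.map g)
  simp only [ampNorm_map, hg] at this
  exact this

end Exactness

end OperatorSpace

end

/-! ### The amalgam and its successive improvements -/

noncomputable section

namespace OperatorSpace

section Amalgamation

/-- A map `φ` into matrices that is given on a complemented subspace `X` of `W`, and that a map `T`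
on `W` dominates up to a factor `1 + η` there, extends to `W`; the extension exceeds `T` only by
the multiple `η` of the norm of the component in `X`. -/
theorem exists_perturbed_extension {H L : Type*} [NormedAddCommGroup H] [InnerProductSpace ℂ H]
    [NormedAddCommGroup L] [InnerProductSpace ℂ L]
    {W : Type*} [AddCommGroup W] [Module ℂ W] {X : Submodule ℂ (H →L[ℂ] H)}
    (T : W →ₗ[ℂ] L →L[ℂ] L) (ι : X →ₗ[ℂ] W) (π : W →ₗ[ℂ] X) (hπ : ∀ x, π (ι x) = x) {η : ℝ}
    (hη : 0 ≤ η) {n : ℕ} (φ : X →ₗ[ℂ] EuclideanSpace ℂ (Fin n) →L[ℂ] EuclideanSpace ℂ (Fin n))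
    (hφ : ∀ (m : ℕ) (v : Matrix (Fin m) (Fin m) X), ampNorm φ v ≤ matNorm v)
    (hT : ∀ (m : ℕ) (v : Matrix (Fin m) (Fin m) X),
      matNorm v ≤ (1 + η) * ampNorm T (v.map ι)) :
    ∃ S : W →ₗ[ℂ] EuclideanSpace ℂ (Fin n) →L[ℂ] EuclideanSpace ℂ (Fin n),
      (∀ x, S (ι x) = φ x) ∧
      (∀ (m : ℕ) (v : Matrix (Fin m) (Fin m) W),
        ampNorm S v ≤ ampNorm T v + η * matNorm (v.map π)) ∧
      ∀ (m : ℕ) (v : Matrix (Fin m) (Fin m) W), v.map π = 0 → ampNorm S v ≤ ampNorm T v := by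
  have h1η : 0 < 1 + η := by linarith
  set c : ℝ := (1 + η)⁻¹ with hc
  have hc0 : 0 ≤ c := by positivity
  have hc1 : c ≤ 1 := inv_le_one_of_one_le₀ (by linarith)
  have hcη : 1 - c ≤ η := by
    rw [hc, sub_le_iff_le_add, ← sub_le_iff_le_add', ← one_div, le_div_iff₀ h1η]
    nlinarith
  obtain ⟨Φ, hΦ, hΦT⟩ := exists_extension T ι (fun x y h => by rw [← hπ x, h, hπ])
    ((c : ℂ) • φ) (fun m v => by
      rw [ampNorm_smul, Complex.norm_real, Real.norm_of_nonneg hc0, hc, inv_mul_le_iff₀ h1η]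
      rw [← ampNorm_map T ι v]
      exact (hφ m v).trans (hT m v))
  have hbound : ∀ (m : ℕ) (v : Matrix (Fin m) (Fin m) W),
      ampNorm (Φ + ((1 - c : ℝ) : ℂ) • (φ ∘ₗ π)) v ≤
        ampNorm T v + (1 - c) * matNorm (v.map π) := by
    intro m v
    refine (ampNorm_add_le _ _ v).trans (add_le_add (hΦT m v) ?_)
    rw [ampNorm_smul, Complex.norm_real, Real.norm_of_nonneg (by linarith), ← ampNorm_map φ π v]
    exact mul_le_mul_of_nonneg_left (hφ m _) (by linarith)
  refine ⟨Φ + ((1 - c : ℝ) : ℂ) • (φ ∘ₗ π), fun x => ?_, fun m v => ?_, fun m v hv => ?_⟩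
  · have h1 : Φ (ι x) = (c : ℂ) • φ x := LinearMap.congr_fun hΦ x
    rw [LinearMap.add_apply, LinearMap.smul_apply, LinearMap.comp_apply, hπ, h1]
    refine (add_smul (c : ℂ) ((1 - c : ℝ) : ℂ) (φ x)).symm.trans ?_
    rw [← Complex.ofReal_add, add_sub_cancel, Complex.ofReal_one]
    exact one_smul ℂ (φ x)
  · exact (hbound m v).trans (add_le_add le_rfl
      (mul_le_mul_of_nonneg_right hcη (ampNorm_nonneg X.subtype _)))
  · refine (hbound m v).trans (le_of_eq ?_)
    rw [matNorm_eq_ampNorm, ampNorm_eq_zero (v := v.map π) (by rw [hv]; ext1; simp), mul_zero,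
      add_zero]

variable {H₁ H₂ : Type*} [NormedAddCommGroup H₁] [InnerProductSpace ℂ H₁]
  [NormedAddCommGroup H₂] [InnerProductSpace ℂ H₂]
  {X : Submodule ℂ (H₁ →L[ℂ] H₁)} {Y : Submodule ℂ (H₂ →L[ℂ] H₂)}

/-- The restrictions of `T` to both summands of `X ⊕ Y` are complete contractions that are
completely isometric up to the factor `1 + η`. -/
structure IsAlmostIsometric (T : MatrixMap (X × Y)) (η : ℝ) : Prop where
  inl_le : ∀ (n : ℕ) (x : Matrix (Fin n) (Fin n) X),
    ampNorm T.2 (x.map (LinearMap.inl ℂ X Y)) ≤ matNorm x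
  le_inl : ∀ (n : ℕ) (x : Matrix (Fin n) (Fin n) X),
    matNorm x ≤ (1 + η) * ampNorm T.2 (x.map (LinearMap.inl ℂ X Y))
  inr_le : ∀ (n : ℕ) (y : Matrix (Fin n) (Fin n) Y),
    ampNorm T.2 (y.map (LinearMap.inr ℂ X Y)) ≤ matNorm y
  le_inr : ∀ (n : ℕ) (y : Matrix (Fin n) (Fin n) Y),
    matNorm y ≤ (1 + η) * ampNorm T.2 (y.map (LinearMap.inr ℂ X Y))

/-- The matricial norm of the `ℓ¹` type on `X ⊕ Y`. -/
def sumNorm {n : ℕ} (v : Matrix (Fin n) (Fin n) (X × Y)) : ℝ :=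
  matNorm (v.map (LinearMap.fst ℂ X Y)) + matNorm (v.map (LinearMap.snd ℂ X Y))

theorem matNorm_nonneg {X : Submodule ℂ (H₁ →L[ℂ] H₁)} {n : ℕ} (x : Matrix (Fin n) (Fin n) X) :
    0 ≤ matNorm x :=
  ampNorm_nonneg X.subtype x

theorem sumNorm_nonneg {n : ℕ} (v : Matrix (Fin n) (Fin n) (X × Y)) : 0 ≤ sumNorm v :=
  add_nonneg (matNorm_nonneg _) (matNorm_nonneg _)

/-- The distortion on both summands can be improved from `η` to any `η'` by a change of the
matricial seminorm on `X ⊕ Y` that is small of the order of `η`. -/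
theorem IsAlmostIsometric.exists_improvement [FiniteDimensional ℂ X] [FiniteDimensional ℂ Y]
    (hX : IsOneExact X) (hY : IsOneExact Y) {T : MatrixMap (X × Y)} {η η' : ℝ} (hη : 0 ≤ η)
    (hη' : 0 < η') (hT : IsAlmostIsometric T η) :
    ∃ T' : MatrixMap (X × Y), IsAlmostIsometric T' η' ∧
      ∀ (n : ℕ) (v : Matrix (Fin n) (Fin n) (X × Y)),
        ampNorm T.2 v ≤ ampNorm T'.2 v ∧ ampNorm T'.2 v ≤ ampNorm T.2 v + η * sumNorm v := by
  obtain ⟨φ, hφ⟩ := hX.exists_matrixMap hη'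
  obtain ⟨ψ, hψ⟩ := hY.exists_matrixMap hη'
  obtain ⟨S₁, hS₁, hS₁T, hS₁0⟩ := exists_perturbed_extension T.2 (LinearMap.inl ℂ X Y)
    (LinearMap.fst ℂ X Y) (fun _ => rfl) hη φ.2 (fun n v => (hφ n v).1) hT.le_inl
  obtain ⟨S₂, hS₂, hS₂T, hS₂0⟩ := exists_perturbed_extension T.2 (LinearMap.inr ℂ X Y)
    (LinearMap.snd ℂ X Y) (fun _ => rfl) hη ψ.2 (fun n v => (hψ n v).1) hT.le_inr
  obtain ⟨S, hS⟩ := exists_ampNorm_eq_max S₁ S₂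
  obtain ⟨T', hT'⟩ := exists_ampNorm_eq_max T.2 S.2
  simp only [hS] at hT'
  have h1 : 0 ≤ 1 + η' := by linarith
  have hl : ∀ (n : ℕ) (x : Matrix (Fin n) (Fin n) X),
      ampNorm S₁ (x.map (LinearMap.inl ℂ X Y)) = ampNorm φ.2 x :=
    fun n x => ampNorm_congr fun i j => hS₁ (x i j)
  have hr : ∀ (n : ℕ) (y : Matrix (Fin n) (Fin n) Y),
      ampNorm S₂ (y.map (LinearMap.inr ℂ X Y)) = ampNorm ψ.2 y :=
    fun n y => ampNorm_congr fun i j => hS₂ (y i j)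
  have hl0 : ∀ (n : ℕ) (x : Matrix (Fin n) (Fin n) X),
      (x.map (LinearMap.inl ℂ X Y)).map (LinearMap.snd ℂ X Y) = 0 := fun n x => rfl
  have hr0 : ∀ (n : ℕ) (y : Matrix (Fin n) (Fin n) Y),
      (y.map (LinearMap.inr ℂ X Y)).map (LinearMap.fst ℂ X Y) = 0 := fun n y => rfl
  refine ⟨T', ⟨fun n x => ?_, fun n x => ?_, fun n y => ?_, fun n y => ?_⟩, fun n v =>
    ⟨(hT' n v).ge.trans' (le_max_left _ _), (hT' n v).le.trans
      (max_le ?_ (max_le ?_ ?_))⟩⟩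
  · have hle := hT.inl_le n x
    exact (hT' n _).le.trans (max_le hle
      (max_le ((hl n x).le.trans (hφ n x).1) ((hS₂0 n _ (hl0 n x)).trans hle)))
  · refine (hφ n x).2.trans (mul_le_mul_of_nonneg_left ?_ h1)
    rw [hT', hl]
    exact le_max_of_le_right (le_max_left _ _)
  · have hle := hT.inr_le n y
    exact (hT' n _).le.trans (max_le hle
      (max_le ((hS₁0 n _ (hr0 n y)).trans hle) ((hr n y).le.trans (hψ n y).1)))
  · refine (hψ n y).2.trans (mul_le_mul_of_nonneg_left ?_ h1)
    rw [hT', hr]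
    exact le_max_of_le_right (le_max_right _ _)
  · exact le_add_of_nonneg_right (mul_nonneg hη (sumNorm_nonneg v))
  · exact (hS₁T n v).trans (add_le_add le_rfl (mul_le_mul_of_nonneg_left
      (le_add_of_nonneg_right (matNorm_nonneg _)) hη))
  · exact (hS₂T n v).trans (add_le_add le_rfl (mul_le_mul_of_nonneg_left
      (le_add_of_nonneg_left (matNorm_nonneg _)) hη))

variable {X₀ : Submodule ℂ (H₁ →L[ℂ] H₁)}

/-- The map `x ↦ (-x, f x)`, whose image measures the failure of the square to commute. -/
def defect (hX₀ : X₀ ≤ X) (f : X₀ →ₗ[ℂ] Y) : X₀ →ₗ[ℂ] X × Y :=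
  LinearMap.inr ℂ X Y ∘ₗ f - LinearMap.inl ℂ X Y ∘ₗ Submodule.inclusion hX₀

theorem defect_apply (hX₀ : X₀ ≤ X) (f : X₀ →ₗ[ℂ] Y) (x : X₀) :
    defect hX₀ f x = (-Submodule.inclusion hX₀ x, f x) := by
  simp [defect]

theorem matNorm_map_inclusion (hX₀ : X₀ ≤ X) {n : ℕ} (x : Matrix (Fin n) (Fin n) X₀) :
    matNorm (x.map (Submodule.inclusion hX₀)) = matNorm x := rfl

set_option maxHeartbeats 1000000 in
/-- A first amalgam, with values in matrices: `X` and `Y` are embedded up to a small distortion,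
and their images of `X₀` differ by little more than `δ`. -/
theorem exists_initial_amalgam [FiniteDimensional ℂ X] [FiniteDimensional ℂ Y]
    (hX : IsOneExact X) (hY : IsOneExact Y) (hX₀ : X₀ ≤ X) (f : X₀ →ₗ[ℂ] Y)
    (hf : Function.Injective f) {δ : ℝ} (hδ : 0 ≤ δ) (hfc : IsCompleteContraction f)
    (hfδ : ∀ (n : ℕ) (x : Matrix (Fin n) (Fin n) X₀), matNorm x ≤ (1 + δ) * matNorm (x.map f))
    {c η : ℝ} (hc : 0 < c) (hc1 : c ≤ 1) (hη : 0 < η) :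
    ∃ T : MatrixMap (X × Y), IsAlmostIsometric T η ∧
      (∃ C : ℝ, 0 ≤ C ∧ ∀ (n : ℕ) (v : Matrix (Fin n) (Fin n) (X × Y)),
        sumNorm v ≤ C * ampNorm T.2 v) ∧
      ∀ (n : ℕ) (x : Matrix (Fin n) (Fin n) X₀),
        ampNorm T.2 (x.map (defect hX₀ f)) ≤ (δ + c) * matNorm x := by
  obtain ⟨φ, hφ⟩ := hX.exists_matrixMap hη
  obtain ⟨ψ, hψ⟩ := hY.exists_matrixMap hη
  have h1δ : 0 < 1 + δ := by linarith
  have h1η : 0 < 1 + η := by linarith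
  set d : ℝ := (1 + δ)⁻¹ with hd
  have hd0 : 0 ≤ d := by positivity
  have hd1 : d ≤ 1 := inv_le_one_of_one_le₀ (by linarith)
  have hdδ : 1 - d ≤ δ := by
    rw [hd, sub_le_iff_le_add, ← sub_le_iff_le_add', ← one_div, le_div_iff₀ h1δ]
    nlinarith
  have hnc : ‖(c : ℂ)‖ = c := by rw [Complex.norm_real, Real.norm_of_nonneg hc.le]
  obtain ⟨A, hA, hAY⟩ := exists_extension Y.subtype f hf
    ((d : ℂ) • (φ.2 ∘ₗ Submodule.inclusion hX₀)) (fun n x => by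
      rw [ampNorm_smul, Complex.norm_real, Real.norm_of_nonneg hd0, hd, inv_mul_le_iff₀ h1δ,
        ← ampNorm_map φ.2 (Submodule.inclusion hX₀) x, ← matNorm_map f x]
      exact (hφ n _).1.trans (hfδ n x))
  obtain ⟨B, hB, hBX⟩ := exists_extension X.subtype (Submodule.inclusion hX₀)
    (Submodule.inclusion_injective hX₀) (ψ.2 ∘ₗ f) (fun n x => by
      rw [← ampNorm_map ψ.2 f x]
      exact (hψ n _).1.trans (hfc n x))
  let p := LinearMap.fst ℂ X Y
  let q := LinearMap.snd ℂ X Y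
  obtain ⟨P, hP⟩ : ∃ P : X × Y →ₗ[ℂ] _, ∀ w, P w = φ.2 w.1 + A w.2 :=
    ⟨φ.2 ∘ₗ p + A ∘ₗ q, fun _ => rfl⟩
  obtain ⟨Q, hQ⟩ : ∃ Q : X × Y →ₗ[ℂ] _, ∀ w, Q w = B w.1 + ψ.2 w.2 :=
    ⟨B ∘ₗ p + ψ.2 ∘ₗ q, fun _ => rfl⟩
  obtain ⟨P', hP'⟩ : ∃ P' : X × Y →ₗ[ℂ] _, ∀ w, P' w = (c : ℂ) • φ.2 w.1 :=
    ⟨(c : ℂ) • (φ.2 ∘ₗ p), fun _ => rfl⟩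
  obtain ⟨Q', hQ'⟩ : ∃ Q' : X × Y →ₗ[ℂ] _, ∀ w, Q' w = (c : ℂ) • ψ.2 w.2 :=
    ⟨(c : ℂ) • (ψ.2 ∘ₗ q), fun _ => rfl⟩
  -- `P'` and `Q'` make the norm of the amalgam comparable with that of `X ⊕ Y`
  obtain ⟨S, hS⟩ := exists_ampNorm_eq_max P Q
  obtain ⟨S', hS'⟩ := exists_ampNorm_eq_max P' Q'
  obtain ⟨T, hT⟩ := exists_ampNorm_eq_max S.2 S'.2
  simp only [hS, hS'] at hT
  have hcmul : ∀ {a b : ℝ}, 0 ≤ b → a ≤ b → c * a ≤ b := fun hb hab =>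
    (mul_le_mul_of_nonneg_left hab hc.le).trans (mul_le_of_le_one_left hb hc1)
  have hl : ∀ (n : ℕ) (x : Matrix (Fin n) (Fin n) X),
      ampNorm T.2 (x.map (LinearMap.inl ℂ X Y)) =
        max (max (ampNorm φ.2 x) (ampNorm B x)) (max (c * ampNorm φ.2 x) 0) := by
    intro n x
    have h1 : ampNorm P (x.map (LinearMap.inl ℂ X Y)) = ampNorm φ.2 x :=
      ampNorm_congr fun i j => by simp [hP]
    have h2 : ampNorm Q (x.map (LinearMap.inl ℂ X Y)) = ampNorm B x :=
      ampNorm_congr fun i j => by simp [hQ]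
    have h3 : ampNorm P' (x.map (LinearMap.inl ℂ X Y)) = ‖(c : ℂ)‖ * ampNorm φ.2 x :=
      ampNorm_eq_norm_mul _ fun i j => hP' _
    have h4 : ampNorm Q' (x.map (LinearMap.inl ℂ X Y)) = 0 :=
      ampNorm_eq_zero (Matrix.ext fun i j => by simp [hQ'])
    rw [hT, h1, h2, h3, h4, hnc]
  have hr : ∀ (n : ℕ) (y : Matrix (Fin n) (Fin n) Y),
      ampNorm T.2 (y.map (LinearMap.inr ℂ X Y)) =
        max (max (ampNorm A y) (ampNorm ψ.2 y)) (max 0 (c * ampNorm ψ.2 y)) := by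
    intro n y
    have h1 : ampNorm P (y.map (LinearMap.inr ℂ X Y)) = ampNorm A y :=
      ampNorm_congr fun i j => by simp [hP]
    have h2 : ampNorm Q (y.map (LinearMap.inr ℂ X Y)) = ampNorm ψ.2 y :=
      ampNorm_congr fun i j => by simp [hQ]
    have h3 : ampNorm P' (y.map (LinearMap.inr ℂ X Y)) = 0 :=
      ampNorm_eq_zero (Matrix.ext fun i j => by simp [hP'])
    have h4 : ampNorm Q' (y.map (LinearMap.inr ℂ X Y)) = ‖(c : ℂ)‖ * ampNorm ψ.2 y :=
      ampNorm_eq_norm_mul _ fun i j => hQ' _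
    rw [hT, h1, h2, h3, h4, hnc]
  refine ⟨T, ⟨fun n x => ?_, fun n x => ?_, fun n y => ?_, fun n y => ?_⟩,
    ⟨2 * ((1 + η) * c⁻¹), by positivity, fun n v => ?_⟩, fun n x => ?_⟩
  · rw [hl]
    exact max_le (max_le (hφ n x).1 (hBX n x))
      (max_le (hcmul (matNorm_nonneg x) (hφ n x).1) (matNorm_nonneg x))
  · refine (hφ n x).2.trans (mul_le_mul_of_nonneg_left ?_ h1η.le)
    rw [hl]
    exact le_max_of_le_left (le_max_left _ _)
  · rw [hr]
    exact max_le (max_le (hAY n y) (hψ n y).1)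
      (max_le (matNorm_nonneg y) (hcmul (matNorm_nonneg y) (hψ n y).1))
  · refine (hψ n y).2.trans (mul_le_mul_of_nonneg_left ?_ h1η.le)
    rw [hr]
    exact le_max_of_le_left (le_max_right _ _)
  · have h3 := (hT n v).ge.trans' (le_max_of_le_right (le_max_left _ _))
    have h4 := (hT n v).ge.trans' (le_max_of_le_right (le_max_right _ _))
    have hP'v : ampNorm P' v = ‖(c : ℂ)‖ * ampNorm φ.2 (v.map p) :=
      ampNorm_eq_norm_mul _ fun i j => hP' (v i j)
    have hQ'v : ampNorm Q' v = ‖(c : ℂ)‖ * ampNorm ψ.2 (v.map q) :=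
      ampNorm_eq_norm_mul _ fun i j => hQ' (v i j)
    rw [hP'v, hnc, ← le_inv_mul_iff₀ hc] at h3
    rw [hQ'v, hnc, ← le_inv_mul_iff₀ hc] at h4
    have h5 := (hφ n (v.map p)).2.trans (mul_le_mul_of_nonneg_left h3 h1η.le)
    have h6 := (hψ n (v.map q)).2.trans (mul_le_mul_of_nonneg_left h4 h1η.le)
    calc sumNorm v ≤ (1 + η) * (c⁻¹ * ampNorm T.2 v) + (1 + η) * (c⁻¹ * ampNorm T.2 v) :=
          add_le_add h5 h6
      _ = _ := by ring
  · have hx := matNorm_nonneg x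
    have hφx : ampNorm φ.2 (x.map (Submodule.inclusion hX₀)) ≤ matNorm x := (hφ n _).1
    have hψx : ampNorm ψ.2 (x.map f) ≤ matNorm x := (hψ n _).1.trans (hfc n x)
    have d1 : ampNorm P (x.map (defect hX₀ f)) =
        ‖((d - 1 : ℝ) : ℂ)‖ * ampNorm φ.2 (x.map (Submodule.inclusion hX₀)) := by
      refine ampNorm_eq_norm_mul _ fun i j => ?_
      have h1 : A (f (x i j)) = (d : ℂ) • φ.2 (Submodule.inclusion hX₀ (x i j)) :=
        LinearMap.congr_fun hA (x i j)
      simp only [Matrix.map_apply, hP, defect_apply, map_neg, h1]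
      have key : ∀ {E : Type} [AddCommGroup E] [Module ℂ E] (a : E),
          -a + (d : ℂ) • a = ((d - 1 : ℝ) : ℂ) • a := fun a => by
        rw [Complex.ofReal_sub, sub_smul, Complex.ofReal_one, one_smul, neg_add_eq_sub]
      exact key _
    have d2 : ampNorm Q (x.map (defect hX₀ f)) = 0 := by
      refine ampNorm_eq_zero (Matrix.ext fun i j => ?_)
      have h1 : B (Submodule.inclusion hX₀ (x i j)) = ψ.2 (f (x i j)) :=
        LinearMap.congr_fun hB (x i j)
      simp only [Matrix.map_apply, hQ, defect_apply, map_neg, h1, neg_add_cancel,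
        Matrix.zero_apply]
    have d3 : ampNorm P' (x.map (defect hX₀ f)) =
        ‖(-c : ℂ)‖ * ampNorm φ.2 (x.map (Submodule.inclusion hX₀)) :=
      ampNorm_eq_norm_mul _ fun i j => by
        simp only [Matrix.map_apply, hP', defect_apply, map_neg, smul_neg, neg_smul]
    have d4 : ampNorm Q' (x.map (defect hX₀ f)) = ‖(c : ℂ)‖ * ampNorm ψ.2 (x.map f) :=
      ampNorm_eq_norm_mul _ fun i j => by
        simp only [Matrix.map_apply, hQ', defect_apply]
    have hle : ∀ {a r : ℝ}, a ≤ matNorm x → 0 ≤ r → r ≤ δ + c → r * a ≤ (δ + c) * matNorm x :=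
      fun ha hr hrδ => (mul_le_mul_of_nonneg_left ha hr).trans (mul_le_mul_of_nonneg_right hrδ hx)
    rw [hT, d1, d2, d3, d4, norm_neg, hnc, Complex.norm_real, Real.norm_of_nonpos (by linarith)]
    exact max_le (max_le (hle hφx (by linarith) (by linarith)) (by positivity))
      (max_le (hle hφx hc.le (by linarith)) (hle hψx hc.le (by linarith)))

/-- Iterated improvement: a sequence of maps into matrices with increasing seminorms whose
distortions on both summands tend to zero, and whose increments are summable relative to the sum
norm. -/
theorem IsAlmostIsometric.exists_sequence [FiniteDimensional ℂ X] [FiniteDimensional ℂ Y]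
    (hX : IsOneExact X) (hY : IsOneExact Y) {e : ℝ} (he0 : 0 < e) {T₀ : MatrixMap (X × Y)}
    (hT₀ : IsAlmostIsometric T₀ (e / 2 ^ (0 + 1))) :
    ∃ R : ℕ → MatrixMap (X × Y), R 0 = T₀ ∧ (∀ k, IsAlmostIsometric (R k) (e / 2 ^ (k + 1))) ∧
      (∀ (n : ℕ) (v : Matrix (Fin n) (Fin n) (X × Y)), Monotone fun k => ampNorm (R k).2 v) ∧
      ∀ (n : ℕ) (v : Matrix (Fin n) (Fin n) (X × Y)) (k l : ℕ),
        ampNorm (R l).2 v ≤ ampNorm (R k).2 v + e / 2 ^ k * sumNorm v := by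
  let η : ℕ → ℝ := fun k => e / 2 ^ (k + 1)
  have hη : ∀ k, 0 < η k := fun k => by positivity
  choose F hF hFT using fun (k : ℕ) (T : MatrixMap (X × Y)) (hT : IsAlmostIsometric T (η k)) =>
    hT.exists_improvement hX hY (hη k).le (hη (k + 1))
  let R' : ∀ k, {T : MatrixMap (X × Y) // IsAlmostIsometric T (η k)} := fun k =>
    Nat.rec ⟨T₀, hT₀⟩ (fun k T => ⟨F k T.1 T.2, hF k T.1 T.2⟩) k
  let R : ℕ → MatrixMap (X × Y) := fun k => (R' k).1
  have hR : ∀ k, IsAlmostIsometric (R k) (η k) := fun k => (R' k).2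
  have hstep : ∀ k (n : ℕ) (v : Matrix (Fin n) (Fin n) (X × Y)),
      ampNorm (R k).2 v ≤ ampNorm (R (k + 1)).2 v ∧
        ampNorm (R (k + 1)).2 v ≤ ampNorm (R k).2 v + η k * sumNorm v :=
    fun k => hFT k (R k) (hR k)
  have hmono : ∀ (n : ℕ) (v : Matrix (Fin n) (Fin n) (X × Y)),
      Monotone fun k => ampNorm (R k).2 v :=
    fun n v => monotone_nat_of_le_succ fun k => (hstep k n v).1
  -- the increments of the seminorms from `k` on add up to `e / 2 ^ k` times the sum norm
  have hanti : ∀ (n : ℕ) (v : Matrix (Fin n) (Fin n) (X × Y)),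
      Antitone fun k => ampNorm (R k).2 v + e / 2 ^ k * sumNorm v := by
    refine fun n v => antitone_nat_of_succ_le fun k => ?_
    have h1 := (hstep k n v).2
    have h2 : e / 2 ^ k = η k + e / 2 ^ (k + 1) := by
      simp only [η, pow_succ]; field_simp; ring
    simp only [h2, add_mul]
    linarith
  have hupper : ∀ (n : ℕ) (v : Matrix (Fin n) (Fin n) (X × Y)) (k l : ℕ),
      ampNorm (R l).2 v ≤ ampNorm (R k).2 v + e / 2 ^ k * sumNorm v := by
    intro n v k l
    have hs := sumNorm_nonneg v
    refine (hmono n v (le_max_right k l)).trans ?_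
    refine le_trans ?_ (hanti n v (le_max_left k l))
    exact le_add_of_nonneg_right (by positivity)
  exact ⟨R, rfl, hR, hmono, hupper⟩

/-- Passage to the limit: a first amalgam whose norm is equivalent to that of `X ⊕ Y` is changed,
by at most `e` times the sum norm, into an amalgam that contains `X` and `Y` completely
isometrically and is `1`-exact. -/
theorem IsAlmostIsometric.exists_limit [FiniteDimensional ℂ X] [FiniteDimensional ℂ Y]
    (hX : IsOneExact X) (hY : IsOneExact Y) {e C : ℝ} (he0 : 0 < e) {T₀ : MatrixMap (X × Y)}
    (hT₀ : IsAlmostIsometric T₀ (e / 2 ^ (0 + 1))) (hC : 0 ≤ C)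
    (hCT : ∀ (n : ℕ) (v : Matrix (Fin n) (Fin n) (X × Y)), sumNorm v ≤ C * ampNorm T₀.2 v) :
    ∃ (K : Type) (_ : NormedAddCommGroup K) (_ : InnerProductSpace ℂ K) (_ : CompleteSpace K)
      (T : X × Y →ₗ[ℂ] K →L[ℂ] K), IsOneExact (LinearMap.range T) ∧
      (∀ (n : ℕ) (x : Matrix (Fin n) (Fin n) X),
        ampNorm T (x.map (LinearMap.inl ℂ X Y)) = matNorm x) ∧
      (∀ (n : ℕ) (y : Matrix (Fin n) (Fin n) Y),
        ampNorm T (y.map (LinearMap.inr ℂ X Y)) = matNorm y) ∧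
      ∀ (n : ℕ) (v : Matrix (Fin n) (Fin n) (X × Y)),
        ampNorm T v ≤ ampNorm T₀.2 v + e * sumNorm v := by
  obtain ⟨R, rfl, hR, hmono, hupper⟩ := hT₀.exists_sequence hX hY he0
  let η : ℕ → ℝ := fun k => e / 2 ^ (k + 1)
  have hη : ∀ k, 0 < η k := fun k => by positivity
  have hbdd : ∀ w, ∃ K : ℝ, 0 ≤ K ∧ ∀ k, ‖(R k).2 w‖ ≤ K := fun w =>
    ⟨_, add_nonneg (ampNorm_nonneg (R 0).2 _) (mul_nonneg (by positivity) (sumNorm_nonneg _)),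
      fun k => (norm_le_ampNorm _ w).trans (hupper 1 _ 0 k)⟩
  obtain ⟨K, _, _, _, T, hT⟩ := exists_directSum R hbdd
  have hRT : ∀ (k n : ℕ) (v : Matrix (Fin n) (Fin n) (X × Y)),
      ampNorm (R k).2 v ≤ ampNorm T v :=
    fun k n v => (hT n v).1 k
  have hTR : ∀ (k n : ℕ) (v : Matrix (Fin n) (Fin n) (X × Y)),
      ampNorm T v ≤ ampNorm (R k).2 v + e / 2 ^ k * sumNorm v := by
    intro k n v
    exact (hT n v).2 _ (add_nonneg (ampNorm_nonneg _ _)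
      (mul_nonneg (by positivity) (sumNorm_nonneg v))) fun l => hupper n v k l
  have hlim : Filter.Tendsto (fun k : ℕ => e / 2 ^ k) Filter.atTop (nhds 0) := by
    have := (tendsto_pow_atTop_nhds_zero_of_lt_one (r := (1 / 2 : ℝ)) (by norm_num)
      (by norm_num)).const_mul e
    simpa [div_eq_mul_inv] using this
  have hη0 : Filter.Tendsto η Filter.atTop (nhds 0) :=
    hlim.comp (Filter.tendsto_add_atTop_nat 1)
  have hinj : Function.Injective T := by
    refine (injective_iff_map_eq_zero T).2 fun w hw => ?_
    have h1 : ampNorm T (Matrix.of fun _ _ : Fin 1 => w) = 0 :=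
      ampNorm_eq_zero (by ext1; simpa using hw)
    have h2 : sumNorm (Matrix.of fun _ _ : Fin 1 => w) ≤ 0 := by
      refine (hCT 1 _).trans ?_
      have := hRT 0 1 (Matrix.of fun _ _ : Fin 1 => w)
      rw [h1] at this
      exact mul_nonpos_of_nonneg_of_nonpos hC this
    have h3 := matNorm_nonneg ((Matrix.of fun _ _ : Fin 1 => w).map (LinearMap.fst ℂ X Y))
    have h4 := matNorm_nonneg ((Matrix.of fun _ _ : Fin 1 => w).map (LinearMap.snd ℂ X Y))
    unfold sumNorm at h2
    have h5 := le_antisymm (by linarith) h3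
    have h6 := le_antisymm (by linarith) h4
    rw [matNorm_map] at h5 h6
    exact Prod.ext (Subtype.ext (eq_zero_of_ampNorm_eq_zero _ h5))
      (Subtype.ext (eq_zero_of_ampNorm_eq_zero _ h6))
  have hexact : IsOneExact (LinearMap.range T) := by
    refine isOneExact_range T hinj fun θ hθ => ?_
    obtain ⟨k, hk⟩ := ((hlim.mul_const C).eventually_lt_const
      (by rwa [zero_mul] : 0 * C < θ)).exists
    refine ⟨R k, fun n v => ⟨hRT k n v, (hTR k n v).trans ?_⟩⟩
    have h1 : sumNorm v ≤ C * ampNorm (R k).2 v :=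
      (hCT n v).trans (mul_le_mul_of_nonneg_left (hmono n v (Nat.zero_le k)) hC)
    have h2 : e / 2 ^ k * sumNorm v ≤ θ * ampNorm (R k).2 v := by
      refine (mul_le_mul_of_nonneg_left h1 (by positivity)).trans ?_
      rw [← mul_assoc]
      exact mul_le_mul_of_nonneg_right hk.le (ampNorm_nonneg _ _)
    linarith
  have hsmall : ∀ {a b : ℝ}, (∀ k, a ≤ (1 + η k) * b) → a ≤ b := by
    intro a b h
    have := ((hη0.const_add 1).mul_const b)
    rw [add_zero, one_mul] at this
    exact ge_of_tendsto' this h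
  refine ⟨K, inferInstance, inferInstance, inferInstance, T, hexact, fun n x => ?_, fun n y => ?_,
    fun n v => by simpa using hTR 0 n v⟩
  · exact le_antisymm ((hT n _).2 _ (matNorm_nonneg x) fun k => (hR k).inl_le n x)
      (hsmall fun k => ((hR k).le_inl n x).trans
        (mul_le_mul_of_nonneg_left (hRT k n _) (by linarith [hη k])))
  · exact le_antisymm ((hT n _).2 _ (matNorm_nonneg y) fun k => (hR k).inr_le n y)
      (hsmall fun k => ((hR k).le_inr n y).trans
        (mul_le_mul_of_nonneg_left (hRT k n _) (by linarith [hη k])))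

theorem sumNorm_defect_le (hX₀ : X₀ ≤ X) {f : X₀ →ₗ[ℂ] Y} (hfc : IsCompleteContraction f) {n : ℕ}
    (x : Matrix (Fin n) (Fin n) X₀) : sumNorm (x.map (defect hX₀ f)) ≤ 2 * matNorm x := by
  have h3 : (x.map (defect hX₀ f)).map (LinearMap.fst ℂ X Y) =
      (-1 : ℂ) • x.map (Submodule.inclusion hX₀) := by
    ext1 i j
    simp only [Matrix.map_apply, Matrix.smul_apply, defect_apply, LinearMap.fst_apply]
    exact (neg_one_smul ℂ _).symm
  have h4 : matNorm ((x.map (defect hX₀ f)).map (LinearMap.fst ℂ X Y)) = matNorm x := by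
    rw [h3]
    refine (ampNorm_apply_smul (-1) X.subtype (x.map (Submodule.inclusion hX₀))).trans ?_
    rw [norm_neg, norm_one, one_mul]
    exact matNorm_map_inclusion hX₀ x
  have h5 : (x.map (defect hX₀ f)).map (LinearMap.snd ℂ X Y) = x.map f := by
    ext1 i j
    simp only [Matrix.map_apply, defect_apply, LinearMap.snd_apply]
  rw [sumNorm, h4, h5]
  linarith [hfc n x]

/-- Near amalgamation, in a finite-dimensional `1`-exact space. -/
theorem exists_amalgam [FiniteDimensional ℂ X] [FiniteDimensional ℂ Y]
    (hX : IsOneExact X) (hY : IsOneExact Y) (hX₀ : X₀ ≤ X) (f : X₀ →ₗ[ℂ] Y)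
    (hf : Function.Injective f) {δ : ℝ} (hδ : 0 ≤ δ) (hfc : IsCompleteContraction f)
    (hfδ : ∀ (n : ℕ) (x : Matrix (Fin n) (Fin n) X₀), matNorm x ≤ (1 + δ) * matNorm (x.map f))
    {ε : ℝ} (hε : 0 < ε) :
    ∃ (K : Type) (_ : NormedAddCommGroup K) (_ : InnerProductSpace ℂ K) (_ : CompleteSpace K)
      (Z : Submodule ℂ (K →L[ℂ] K)) (i : X →ₗ[ℂ] Z) (j : Y →ₗ[ℂ] Z),
      FiniteDimensional ℂ Z ∧ IsOneExact Z ∧ IsCompleteIsometry i ∧ IsCompleteIsometry j ∧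
      cbNorm (j ∘ₗ f - i ∘ₗ Submodule.inclusion hX₀) ≤ ENNReal.ofReal (δ + ε) := by
  obtain ⟨T₀, hT₀, ⟨C, hC, hCT⟩, hdef⟩ := exists_initial_amalgam hX hY hX₀ f hf hδ hfc hfδ
    (c := min 1 (ε / 2)) (η := ε / 4 / 2 ^ (0 + 1)) (by positivity) (min_le_left _ _)
    (by positivity)
  obtain ⟨K, _, _, _, T, hexact, hinl, hinr, hT⟩ :=
    hT₀.exists_limit hX hY (e := ε / 4) (by positivity) hC hCT
  refine ⟨K, inferInstance, inferInstance, inferInstance, LinearMap.range T,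
    T.rangeRestrict ∘ₗ LinearMap.inl ℂ X Y, T.rangeRestrict ∘ₗ LinearMap.inr ℂ X Y,
    inferInstance, hexact, hinl, hinr, cbNorm_le (by positivity) fun n x => ?_⟩
  have h1 : (T.rangeRestrict ∘ₗ LinearMap.inr ℂ X Y) ∘ₗ f -
        (T.rangeRestrict ∘ₗ LinearMap.inl ℂ X Y) ∘ₗ Submodule.inclusion hX₀ =
      T.rangeRestrict ∘ₗ defect hX₀ f := by
    rw [defect, LinearMap.comp_sub, LinearMap.comp_assoc, LinearMap.comp_assoc]
  rw [h1, matNorm_map_rangeRestrict]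
  have h2 : ampNorm T₀.2 (x.map (defect hX₀ f)) ≤ (δ + ε / 2) * matNorm x :=
    (hdef n x).trans (mul_le_mul_of_nonneg_right
      (add_le_add le_rfl (min_le_right _ _)) (matNorm_nonneg x))
  have h3 := mul_le_mul_of_nonneg_left (sumNorm_defect_le hX₀ hfc x)
    (by positivity : 0 ≤ ε / 4)
  refine (hT n _).trans ((add_le_add h2 h3).trans (le_of_eq ?_))
  ring

end Amalgamation

end OperatorSpace

end

/-! ### The near amalgamation property -/

noncomputable section

namespace OperatorSpace

/-- The bound on `f⁻¹`, read as a lower bound for `f`. -/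
theorem matNorm_le_of_cbNorm_inverseOnRange {H K : Type*}
    [NormedAddCommGroup H] [InnerProductSpace ℂ H] [NormedAddCommGroup K] [InnerProductSpace ℂ K]
    {X : Submodule ℂ (H →L[ℂ] H)} {Y : Submodule ℂ (K →L[ℂ] K)} {f : X →ₗ[ℂ] Y}
    (hf : Function.Injective f) {c : ℝ} (hc : 0 ≤ c)
    (h : cbNorm (inverseOnRange f hf) ≤ ENNReal.ofReal c) (n : ℕ)
    (x : Matrix (Fin n) (Fin n) X) : matNorm x ≤ c * matNorm (x.map f) := by
  let e := LinearEquiv.ofInjective (Y.subtype ∘ₗ f) (subtype_comp_injective hf)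
  have h1 := matNorm_map_le hc h (x.map e.toLinearMap)
  have h2 : (x.map e.toLinearMap).map (inverseOnRange f hf) = x := by
    ext1 i j
    exact e.symm_apply_apply (x i j)
  rw [h2] at h1
  exact h1

theorem IsCompleteIsometry.injective {H K : Type*}
    [NormedAddCommGroup H] [InnerProductSpace ℂ H] [NormedAddCommGroup K] [InnerProductSpace ℂ K]
    {X : Submodule ℂ (H →L[ℂ] H)} {Y : Submodule ℂ (K →L[ℂ] K)} {f : X →ₗ[ℂ] Y}
    (hf : IsCompleteIsometry f) : Function.Injective f := by
  refine (injective_iff_map_eq_zero f).2 fun x hx => ?_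
  have h1 : matNorm ((Matrix.of fun _ _ : Fin 1 => x).map f) = 0 := by
    rw [matNorm_map]
    refine ampNorm_eq_zero (Matrix.ext fun i j => ?_)
    rw [Matrix.map_apply, LinearMap.comp_apply, Matrix.of_apply, hx, map_zero, Matrix.zero_apply]
  rw [hf] at h1
  exact Subtype.ext (eq_zero_of_ampNorm_eq_zero X.subtype h1)

end OperatorSpace

end

theorem mainTheorem5
    {H₁ : Type*} [NormedAddCommGroup H₁] [InnerProductSpace ℂ H₁] [CompleteSpace H₁]
    {H₂ : Type*} [NormedAddCommGroup H₂] [InnerProductSpace ℂ H₂] [CompleteSpace H₂]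
    (X₀ X : Submodule ℂ (H₁ →L[ℂ] H₁)) (hX₀ : X₀ ≤ X)
    (Y : Submodule ℂ (H₂ →L[ℂ] H₂))
    (hXfin : FiniteDimensional ℂ X) (hYfin : FiniteDimensional ℂ Y)
    (hX : OperatorSpace.IsOneExact X) (hY : OperatorSpace.IsOneExact Y) :
    -- approximate amalgamation over a complete contraction with almost contractive inverse
    (∀ (δ : ℝ), 0 ≤ δ → ∀ (f : X₀ →ₗ[ℂ] Y) (hf : Function.Injective f),
      OperatorSpace.IsCompleteContraction f →
      OperatorSpace.cbNorm (OperatorSpace.inverseOnRange f hf) ≤ ENNReal.ofReal (1 + δ) →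
      ∀ (ε : ℝ), 0 < ε →
        ∃ (K : Type) (_ : NormedAddCommGroup K) (_ : InnerProductSpace ℂ K) (_ : CompleteSpace K)
          (Z : Submodule ℂ (K →L[ℂ] K)) (i : X →ₗ[ℂ] Z) (j : Y →ₗ[ℂ] Z),
          IsClosed (Z : Set (K →L[ℂ] K)) ∧
          TopologicalSpace.SeparableSpace Z ∧
          OperatorSpace.IsOneExact Z ∧
          OperatorSpace.IsCompleteIsometry i ∧
          OperatorSpace.IsCompleteIsometry j ∧
          OperatorSpace.cbNorm (j ∘ₗ f - i ∘ₗ Submodule.inclusion hX₀) ≤ ENNReal.ofReal (δ + ε)) ∧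
    -- near amalgamation property of the class of finite-dimensional `1`-exact operator spaces
    (∀ (f : X₀ →ₗ[ℂ] Y), OperatorSpace.IsCompleteIsometry f →
      ∀ (ε : ℝ), 0 < ε →
        ∃ (K : Type) (_ : NormedAddCommGroup K) (_ : InnerProductSpace ℂ K) (_ : CompleteSpace K)
          (Z : Submodule ℂ (K →L[ℂ] K)) (i : X →ₗ[ℂ] Z) (j : Y →ₗ[ℂ] Z),
          FiniteDimensional ℂ Z ∧
          OperatorSpace.IsOneExact Z ∧
          OperatorSpace.IsCompleteIsometry i ∧
          OperatorSpace.IsCompleteIsometry j ∧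
          OperatorSpace.cbNorm (j ∘ₗ f - i ∘ₗ Submodule.inclusion hX₀) ≤ ENNReal.ofReal ε) := by
  refine ⟨fun δ hδ f hf hfc hinv ε hε => ?_, fun f hfi ε hε => ?_⟩
  · obtain ⟨K, _, _, _, Z, i, j, hZ, hexact, hi, hj, hij⟩ :=
      OperatorSpace.exists_amalgam hX hY hX₀ f hf hδ hfc
        (OperatorSpace.matNorm_le_of_cbNorm_inverseOnRange hf (by linarith) hinv) hε
    -- a finite-dimensional space is closed and separable
    have : ProperSpace Z := FiniteDimensional.proper ℂ Z
    exact ⟨K, inferInstance, inferInstance, inferInstance, Z, i, j,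
      Z.closed_of_finiteDimensional, inferInstance, hexact, hi, hj, hij⟩
  · have h := OperatorSpace.exists_amalgam hX hY hX₀ f hfi.injective le_rfl
      (fun n x => (hfi n x).le) (fun n x => by rw [add_zero, one_mul, hfi]) hε
    rwa [zero_add] at h
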